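/- Let $K$ be a CM field with maximal totally real subfield $E$, let $x\mapsto\bar x$ be the non-trivial element of $\mathrm{Gal}(K/E)$, and for every $E$-algebra $R$ extend it $R$-linearly to $R\otimes_E K$. Put $\mathbb A_K=\mathbb A_E\otimes_E K$ and $K_v=E_v\otimes_E K$ for each place $v$ of $E$. Let $n\ge 0$, let $\mathrm{Her}_n(K)$ and $\mathrm{Her}_n(K_v)$ be the Hermitian $n\times n$ matrices over $K$ and $K_v$, let $\eta=\begin{pmatrix}0&-1_n\\1_n&0\end{pmatrix}$, and let $GU(R)=\{g\in \mathrm{GL}_{2n}(R\otimes_E K): g\,\eta\,{}^t\bar g=\nu\eta \text{ for some }\nu\in R^\times\}$. Let $|\cdot|_E=\prod_v|\cdot|_v$ be the normalized adelic absolute value on $\mathbb A_E^\times$. Let $\chi=\prod_v\chi_v$ be a Hecke character of $K$, let $s\in\mathbb C$, and let $f=\otimes_v f_v$ be a factorizable Siegel section: for every place $v$ of $E$, $f_v:GU(E_v)\to\mathbb C$ satisfies $$f_v\left(\begin{pmatrix}{}^t\bar h^{-1}&0\\0&\lambda h\end{pmatrix}\begin{pmatrix}1&b\\0&1\end{pmatrix}g\right)=\chi_v(a)\,|a\bar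 a|_v^{-s}\,f_v(g),\qquad a=\det(\lambda h),$$ for all $h\in \mathrm{GL}_n(K_v)$, $\lambda\in E_v^\times$, $b\in \mathrm{Her}_n(K_v)$ and $g\in GU(E_v)$. For an adelic Hermitian matrix $\beta$ and $g\in GU(\mathbb A_E)$ define $$c(\beta,g;f)=C(n,K)\prod_v\int_{\mathrm{Her}_n(K_v)}f_v\left(\eta\begin{pmatrix}1&m\\0&1\end{pmatrix}g_v\right)\mathbf e_v(-\mathrm{tr}(\beta_v m))\,d_vm,$$ where $C(n,K)=2^{n(n-1)[E:\mathbb Q]/2}|D_E|^{-n/2}|D_K|^{-n(n-1)/4}$ with $D_E,D_K$ the discriminants, $\mathbf e_v(x)=e^{2\pi i x}$ for $v\mid\infty$, $\mathbf e_v(x)=e^{-2\pi i y}$ with $y\in\mathbb Z[1/q]$ and $\mathrm{tr}_{E_v/\mathbb Q_q}(x)-y\in\mathbb Z_q$ for $v\mid q$, and $d_v$ is the Haar measure that gives $\mathrm{Her}_n(\mathcal O_{E_v}\otimes\mathcal O_K)$ measure $1$ if $v$ is finite and equals $\left|\bigwedge_j dx_{jj}\bigwedge_{j<k}(2^{-1}dx_{jk}\wedge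 d\bar x_{jk})\right|$ if $v\mid\infty$. Then for all $h\in \mathrm{GL}_n(\mathbb A_K)$, $\lambda\in\mathbb A_E^\times$ and $\beta\in \mathrm{Her}_n(K)$, the integrals and the product that define $c\left(\beta,\begin{pmatrix}{}^t\bar h^{-1}&0\\0&\lambda h\end{pmatrix};f\right)$ converge (absolutely, respectively unconditionally) if and only if those that define $c(\lambda^{-1}h^{-1}\beta\,{}^t\bar h^{-1},1;f)$ do, and in that case $$c\left(\beta,\begin{pmatrix}{}^t\bar h^{-1}&0\\0&\lambda h\end{pmatrix};f\right)=|\lambda|_E^{-n^2}\,\chi(\det {}^t\bar h^{-1})\,\left|\det({}^t\bar h^{-1}h^{-1})\right|_E^{\,n-s}\,c\left(\lambda^{-1}h^{-1}\beta\,{}^t\bar h^{-1},\,1;\,f\right).$$ -/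

import Mathlib

open scoped TensorProduct Matrix
open NumberField IsDedekindDomain MeasureTheory

noncomputable section

namespace SiegelSim

/-! ### Linear algebra over `R ⊗[E] K` for an `E`-algebra `R` -/

section LinearAlgebra

variable {E K : Type*} [Field E] [Field K] [Algebra E K] (ε : K ≃ₐ[E] K) (n : ℕ)
variable (R : Type*) [CommRing R] [Algebra E R]

/-- The involution of `R ⊗ K` induced by the involution `ε` of `K` over `E`. -/
def conj : (R ⊗[E] K) →ₐ[R] (R ⊗[E] K) :=
  Algebra.TensorProduct.map (AlgHom.id R R) ε.toAlgHom

variable {R}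

/-- For `x` in the image of `R → R ⊗ K`, the element of `R` with which `x` is identified. -/
def toBase (x : R ⊗[E] K) : R := Function.invFun (algebraMap R (R ⊗[E] K)) x

/-- The conjugate transpose of a matrix over `R ⊗ K`. -/
def ct {m : Type*} (M : Matrix m m (R ⊗[E] K)) : Matrix m m (R ⊗[E] K) :=
  (M.map (conj ε R))ᵀ

variable (R) in
/-- Hermitian `n × n` matrices over `R ⊗ K`, as an `R`-submodule of all matrices. -/
def hermSubmodule : Submodule R (Matrix (Fin n) (Fin n) (R ⊗[E] K)) where
  carrier := {M | ct ε M = M}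
  add_mem' := by
    intro a b ha hb
    ext i j
    have h1 := congrFun (congrFun ha i) j
    have h2 := congrFun (congrFun hb i) j
    simp only [ct, Matrix.transpose_apply, Matrix.map_apply] at h1 h2
    simp [ct, h1, h2]
  zero_mem' := by ext i j; simp [ct]
  smul_mem' := by
    intro c a ha
    ext i j
    have h1 := congrFun (congrFun ha i) j
    simp only [ct, Matrix.transpose_apply, Matrix.map_apply] at h1
    simp [ct, h1]

variable (R) in
/-- The `R`-module `Her_n(R ⊗ K)`. -/
def Her : Type _ := hermSubmodule ε n R

instance : AddCommGroup (Her ε n R) := inferInstanceAs (AddCommGroup (hermSubmodule ε n R))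

instance : Module R (Her ε n R) := inferInstanceAs (Module R (hermSubmodule ε n R))

variable {ε n}

/-- The matrix underlying an element of `Her_n(R ⊗ K)`. -/
def Her.mat (b : Her ε n R) : Matrix (Fin n) (Fin n) (R ⊗[E] K) := b.1

theorem Her.ct_mat (b : Her ε n R) : ct ε b.mat = b.mat := b.2

theorem aut_mul_self [Algebra.IsQuadraticExtension E K] (e : K ≃ₐ[E] K) : e * e = 1 := by
  have h2 : Module.finrank E K = 2 := Algebra.IsQuadraticExtension.finrank_eq_two E K
  have : FiniteDimensional E K := Module.finite_of_finrank_eq_succ h2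
  have hc : Fintype.card (K ≃ₐ[E] K) ≤ 2 := h2 ▸ AlgEquiv.card_le
  have hp : 0 < Fintype.card (K ≃ₐ[E] K) := Fintype.card_pos
  have he := pow_card_eq_one (x := e)
  rcases (by omega : Fintype.card (K ≃ₐ[E] K) = 1 ∨ Fintype.card (K ≃ₐ[E] K) = 2) with h | h
  · rw [h, pow_one] at he; simp [he]
  · rw [h, pow_two] at he; exact he

theorem conj_conj [Algebra.IsQuadraticExtension E K] (x : R ⊗[E] K) :
    conj ε R (conj ε R x) = x := by
  induction x with
  | zero => simp
  | tmul r k =>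
    have : ε (ε k) = k := congrArg (fun e : K ≃ₐ[E] K => e k) (aut_mul_self ε)
    simp [conj, this]
  | add x y hx hy => rw [map_add, map_add, hx, hy]

variable (ε) in
theorem ct_mul {m : Type*} [Fintype m] (A B : Matrix m m (R ⊗[E] K)) :
    ct ε (A * B) = ct ε B * ct ε A := by
  simp [ct, Matrix.map_mul, Matrix.transpose_mul]

variable (ε) in
theorem ct_one {m : Type*} [DecidableEq m] :
    ct ε (1 : Matrix m m (R ⊗[E] K)) = 1 := by
  simp [ct]

variable (ε) in
theorem ct_zero {m : Type*} : ct ε (0 : Matrix m m (R ⊗[E] K)) = 0 := by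
  ext i j; simp [ct]

variable (ε) in
theorem ct_neg {m : Type*} (A : Matrix m m (R ⊗[E] K)) : ct ε (-A) = -ct ε A := by
  ext i j; simp [ct]

variable (ε) in
theorem ct_smul {m : Type*} (l : R) (A : Matrix m m (R ⊗[E] K)) :
    ct ε (l • A) = l • ct ε A := by
  ext i j; simp [ct]

theorem ct_ct [Algebra.IsQuadraticExtension E K] {m : Type*} (A : Matrix m m (R ⊗[E] K)) :
    ct ε (ct ε A) = A := by
  ext i j; simp [ct, conj_conj]

theorem ct_fromBlocks (A B C D : Matrix (Fin n) (Fin n) (R ⊗[E] K)) :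
    ct ε (Matrix.fromBlocks A B C D) =
      Matrix.fromBlocks (ct ε A) (ct ε C) (ct ε B) (ct ε D) := by
  simp [ct, Matrix.fromBlocks_map, Matrix.fromBlocks_transpose]

end LinearAlgebra

/-! ### The unitary similitude group -/

section Group

variable {E K : Type*} [Field E] [Field K] [Algebra E K] (ε : K ≃ₐ[E] K) (n : ℕ)
variable (R : Type*) [CommRing R] [Algebra E R]

/-- The matrix `η = (0, -1; 1, 0)`. -/
def etaMat : Matrix (Fin n ⊕ Fin n) (Fin n ⊕ Fin n) (R ⊗[E] K) :=
  Matrix.fromBlocks 0 (-1) 1 0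

/-- The group `GU(η)(R)` of all `g ∈ GL_{2n}(R ⊗ K)` with `g η ᵗḡ = ν η` for some `ν ∈ Rˣ`. -/
def GU : Subgroup (GL (Fin n ⊕ Fin n) (R ⊗[E] K)) where
  carrier := {g | ∃ ν : Rˣ, g.val * etaMat n R * ct ε g.val = (ν : R) • etaMat n R}
  mul_mem' := by
    rintro a b ⟨x, hx⟩ ⟨y, hy⟩
    refine ⟨x * y, ?_⟩
    calc (a * b).val * etaMat n R * ct ε (a * b).val
        = a.val * (b.val * etaMat n R * ct ε b.val) * ct ε a.val := by
          rw [Units.val_mul, ct_mul]; simp only [Matrix.mul_assoc]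
      _ = _ := by
          rw [hy, Matrix.mul_smul, Matrix.smul_mul, hx, smul_smul, Units.val_mul, mul_comm]
  one_mem' := ⟨1, by simp [ct_one]⟩
  inv_mem' := by
    rintro a ⟨x, hx⟩
    refine ⟨x⁻¹, ?_⟩
    have h1 : (a⁻¹).val * a.val = 1 := by rw [← Units.val_mul]; simp
    have h2 : ct ε a.val * ct ε (a⁻¹).val = 1 := by
      rw [← ct_mul, h1, ct_one]
    calc (a⁻¹).val * etaMat n R * ct ε (a⁻¹).val
        = (x⁻¹ : Rˣ).val • ((a⁻¹).val * ((x : R) • etaMat n R) * ct ε (a⁻¹).val) := by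
          rw [Matrix.mul_smul, Matrix.smul_mul, smul_smul]; simp
      _ = (x⁻¹ : Rˣ).val • (((a⁻¹).val * a.val) * etaMat n R *
            (ct ε a.val * ct ε (a⁻¹).val)) := by
          rw [← hx]; simp only [Matrix.mul_assoc]
      _ = _ := by rw [h1, h2]; simp

variable {R n}

/-- The element `η` of `GU(η)(R)`. -/
def etaGU : GU ε n R :=
  ⟨⟨etaMat n R, -etaMat n R,
    by simp [etaMat, Matrix.fromBlocks_multiply, Matrix.fromBlocks_neg],
    by simp [etaMat, Matrix.fromBlocks_multiply, Matrix.fromBlocks_neg]⟩, 1, by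
      simp [etaMat, ct_fromBlocks, Matrix.fromBlocks_multiply, ct_one, ct_zero, ct_neg]⟩

/-- The unipotent element `(1, b; 0, 1)` of `GU(η)(R)`, for `b ∈ Her_n(R ⊗ K)`. -/
def nGU (b : Her ε n R) : GU ε n R :=
  ⟨⟨Matrix.fromBlocks 1 b.mat 0 1, Matrix.fromBlocks 1 (-b.mat) 0 1,
    by simp [Matrix.fromBlocks_multiply], by simp [Matrix.fromBlocks_multiply]⟩, 1, by
      simp [etaMat, ct_fromBlocks, Matrix.fromBlocks_multiply, ct_one, ct_zero, b.ct_mat]⟩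

/-- The Levi element `diag(ᵗh̄⁻¹, λ h)` of `GU(η)(R)`, for `h ∈ GL_n(R ⊗ K)` and `λ ∈ Rˣ`. -/
def mGU [Algebra.IsQuadraticExtension E K] (h : GL (Fin n) (R ⊗[E] K)) (l : Rˣ) : GU ε n R :=
  ⟨⟨Matrix.fromBlocks (ct ε (h⁻¹).val) 0 0 ((l : R) • h.val),
    Matrix.fromBlocks (ct ε h.val) 0 0 (((l⁻¹ : Rˣ) : R) • (h⁻¹).val),
    by
      have h1 : h.val * (h⁻¹).val = 1 := by rw [← Units.val_mul]; simp
      simp only [Matrix.fromBlocks_multiply, ← ct_mul, h1, ct_one, Matrix.smul_mul,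
        Matrix.mul_smul, smul_smul]
      simp,
    by
      have h1 : (h⁻¹).val * h.val = 1 := by rw [← Units.val_mul]; simp
      simp only [Matrix.fromBlocks_multiply, ← ct_mul, h1, ct_one, Matrix.smul_mul,
        Matrix.mul_smul, smul_smul]
      simp⟩, l, by
      simp [etaMat, ct_fromBlocks, Matrix.fromBlocks_multiply, ct_ct, ct_smul, ct_zero,
        Matrix.fromBlocks_smul, ← ct_mul, ct_one]⟩

variable {S : Type*} [CommRing S] [Algebra E S] (π : R →ₐ[E] S)

/-- The base change `R ⊗ K → S ⊗ K` of a morphism `R → S` of `E`-algebras. -/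
def baseMap (K : Type*) [Field K] [Algebra E K] : (R ⊗[E] K) →ₐ[E] (S ⊗[E] K) :=
  Algebra.TensorProduct.map π (AlgHom.id E K)

theorem baseMap_conj (x : R ⊗[E] K) :
    baseMap π K (conj ε R x) = conj ε S (baseMap π K x) := by
  induction x with
  | zero => simp
  | tmul r k => simp [baseMap, conj]
  | add x y hx hy => simp only [map_add, hx, hy]

theorem baseMap_ct {m : Type*} (A : Matrix m m (R ⊗[E] K)) :
    (ct ε A).map (baseMap π K) = ct ε (A.map (baseMap π K)) := by
  ext i j; simp [ct, baseMap_conj]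

/-- The map `GU(η)(R) → GU(η)(S)` induced by a morphism `R → S` of `E`-algebras. -/
def GU.map (g : GU ε n R) : GU ε n S :=
  ⟨Matrix.GeneralLinearGroup.map (baseMap π K : (R ⊗[E] K) →+* (S ⊗[E] K)) g.1, by
    obtain ⟨g, ν, hg⟩ := g
    refine ⟨Units.map (π : R →* S) ν, ?_⟩
    have h := congrArg (fun A => A.map (baseMap π K)) hg
    simp only [Matrix.map_mul, baseMap_ct] at h
    have he : (etaMat n R : Matrix _ _ (R ⊗[E] K)).map (baseMap π K) = etaMat n S := by
      ext i j
      rcases i with i | i <;> rcases j with j | j <;>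
        simp [etaMat, Matrix.one_apply, apply_ite (baseMap π K)]
    have hs : ((ν : R) • (etaMat n R : Matrix _ _ (R ⊗[E] K))).map (baseMap π K) =
        (π ν) • etaMat n S := by
      rw [← he]
      ext i j
      simp only [Matrix.map_apply, Matrix.smul_apply]
      rw [Algebra.smul_def, Algebra.smul_def, map_mul]
      simp [baseMap, Algebra.TensorProduct.algebraMap_apply]
    rw [he, hs] at h
    exact h⟩

/-- A multiplicative but not necessarily unital `E`-linear map `R → S` induces a homomorphism
`(R ⊗ K)ˣ → (S ⊗ K)ˣ`: it is `x ↦ T x + (1 - T 1)` for the induced map `T : R ⊗ K → S ⊗ K`.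
For the inclusion of a factor `R` of a product `S`, this inserts `1` at the other factors. -/
def extendByOne (K : Type*) [Field K] [Algebra E K] (ι : R →ₗ[E] S)
    (hι : ∀ x y, ι (x * y) = ι x * ι y) : (R ⊗[E] K)ˣ →* (S ⊗[E] K)ˣ :=
  have hT : ∀ x y : R ⊗[E] K,
      ι.rTensor K (x * y) = ι.rTensor K x * ι.rTensor K y := by
    intro x y
    induction x with
    | zero => simp
    | tmul r k =>
      induction y with
      | zero => simp
      | tmul r' k' => simp [hι]
      | add y z hy hz => rw [mul_add, map_add, map_add, mul_add, hy, hz]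
    | add x z hx hz => rw [add_mul, map_add, map_add, add_mul, hx, hz]
  Units.liftRight
    { toFun := fun x => ι.rTensor K (x : R ⊗[E] K) + (1 - ι.rTensor K (1 : R ⊗[E] K))
      map_one' := by simp
      map_mul' := by
        intro x y
        have h1 := hT x.1 1
        have h2 := hT 1 y.1
        have h3 := hT (1 : R ⊗[E] K) 1
        simp only [mul_one, one_mul] at h1 h2 h3
        rw [Units.val_mul, hT]
        linear_combination -h1 - h2 + h3 }
    (fun x =>
      ⟨ι.rTensor K (x : R ⊗[E] K) + (1 - ι.rTensor K (1 : R ⊗[E] K)),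
       ι.rTensor K ((x⁻¹ : (R ⊗[E] K)ˣ) : R ⊗[E] K) + (1 - ι.rTensor K (1 : R ⊗[E] K)),
       by
        have h1 := hT x.1 1
        have h2 := hT 1 (x⁻¹).1
        have h3 := hT (1 : R ⊗[E] K) 1
        have h4 := hT x.1 (x⁻¹).1
        simp only [mul_one, one_mul, Units.mul_inv] at h1 h2 h3 h4
        linear_combination h1 + h2 - h3 - h4,
       by
        have h1 := hT (x⁻¹).1 1
        have h2 := hT 1 x.1
        have h3 := hT (1 : R ⊗[E] K) 1
        have h4 := hT (x⁻¹).1 x.1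
        simp only [mul_one, one_mul, Units.inv_mul] at h1 h2 h3 h4
        linear_combination h1 + h2 - h3 - h4⟩)
    (fun _ => rfl)

end Group

/-! ### Local and adelic data attached to a number field `E` -/

section Places

variable (E : Type*) [Field E] [NumberField E]

/-- The adele ring of `E`. The adele ring of `K` is used in the form `A_E ⊗[E] K`. -/
abbrev AE : Type _ := AdeleRing (𝓞 E) E

variable {E}

/-- The projection `A_E → E_v` at an infinite place. -/
def compInf (v : InfinitePlace E) : AE E →ₐ[E] v.Completion where
  toFun x := x.1 v
  map_one' := rfl
  map_mul' _ _ := rfl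
  map_zero' := rfl
  map_add' _ _ := rfl
  commutes' _ := rfl

/-- The projection `A_E → E_v` at a finite place. -/
def compFin (v : HeightOneSpectrum (𝓞 E)) : AE E →ₐ[E] v.adicCompletion E where
  toFun x := x.2 v
  map_one' := rfl
  map_mul' _ _ := rfl
  map_zero' := rfl
  map_add' _ _ := rfl
  commutes' _ := rfl

open scoped Classical in
/-- The inclusion `E_v → A_E` at an infinite place, zero at all other places. -/
def inclInf (v : InfinitePlace E) : v.Completion →ₗ[E] AE E where
  toFun x := (Pi.single v x, 0)
  map_add' x y := by
    refine Prod.ext ?_ ?_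
    · exact Pi.single_add (f := fun w : InfinitePlace E => w.Completion) v x y
    · exact (add_zero (0 : FiniteAdeleRing (𝓞 E) E)).symm
  map_smul' c x := by
    refine Prod.ext ?_ ?_
    · exact Pi.single_smul (f := fun w : InfinitePlace E => w.Completion) v c x
    · exact (smul_zero (A := FiniteAdeleRing (𝓞 E) E) c).symm

theorem inclInf_mul (v : InfinitePlace E) (x y : v.Completion) :
    inclInf v (x * y) = inclInf v x * inclInf v y := by
  classical
  refine Prod.ext ?_ ?_
  · exact Pi.single_mul (α := fun w : InfinitePlace E => w.Completion) v x y
  · exact (mul_zero (0 : FiniteAdeleRing (𝓞 E) E)).symm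

open scoped Classical in
/-- The finite adele with component `x` at `v` and zero at all other places. -/
def finSingle (v : HeightOneSpectrum (𝓞 E)) (x : v.adicCompletion E) :
    FiniteAdeleRing (𝓞 E) E :=
  ⟨Pi.single v x, by
    refine (Set.finite_singleton v).subset ?_
    intro w hw
    by_contra hne
    apply hw
    have : (Pi.single v x : (w : HeightOneSpectrum (𝓞 E)) → w.adicCompletion E) w = 0 :=
      Pi.single_eq_of_ne hne x
    simp only [Set.mem_ofPred_eq, this]
    exact zero_mem _⟩

/-- The inclusion `E_v → A_E` at a finite place, zero at all other places. -/
def inclFin (v : HeightOneSpectrum (𝓞 E)) : v.adicCompletion E →ₗ[E] AE E where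
  toFun x := (0, finSingle v x)
  map_add' x y := by
    classical
    refine Prod.ext ?_ (Subtype.ext ?_)
    · exact (add_zero (0 : InfiniteAdeleRing E)).symm
    · exact Pi.single_add (f := fun w : HeightOneSpectrum (𝓞 E) => w.adicCompletion E) v x y
  map_smul' c x := by
    classical
    refine Prod.ext ?_ (Subtype.ext ?_)
    · exact (smul_zero (A := InfiniteAdeleRing E) c).symm
    · refine (Pi.single_smul (f := fun w : HeightOneSpectrum (𝓞 E) => w.adicCompletion E)
        v c x).trans (funext fun w => ?_)
      exact Algebra.smul_def (A := w.adicCompletion E) c _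

theorem inclFin_mul (v : HeightOneSpectrum (𝓞 E)) (x y : v.adicCompletion E) :
    inclFin v (x * y) = inclFin v x * inclFin v y := by
  classical
  refine Prod.ext ?_ (Subtype.ext ?_)
  · exact (mul_zero (0 : InfiniteAdeleRing E)).symm
  · exact Pi.single_mul (α := fun w : HeightOneSpectrum (𝓞 E) => w.adicCompletion E) v x y

/-- The adelic absolute value `|x|_E = ∏_v |x_v|_v` for totally real `E`; at a finite place the
norm of a uniformizer is the inverse of the cardinality of the residue field. For an idele almost
all factors are `1`. -/
def adelicAbs (x : AE E) : ℝ :=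
  (∏ v : InfinitePlace E, ‖compInf v x‖) * ∏ᶠ v : HeightOneSpectrum (𝓞 E), ‖compFin v x‖

/-- The additive character `x ↦ exp(2πix)` of `E_v = ℝ` at a real place. -/
def charInf (v : InfinitePlace E) (x : v.Completion) : ℂ :=
  Complex.exp (2 * Real.pi * Complex.I * InfinitePlace.Completion.extensionEmbedding v x)

/-- The subfield `ℚ_q` of `E_v`, realized as the closure of `ℚ`. -/
def padicSubfield (v : HeightOneSpectrum (𝓞 E)) : Subfield (v.adicCompletion E) :=
  (algebraMap ℚ (v.adicCompletion E)).fieldRange.topologicalClosure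

/-- The additive character of `E_v` at a finite place `v` over the rational prime `q`:
`x ↦ exp(-2πiy)`, where `y ∈ ℤ[1/q]` and `Tr_{E_v/ℚ_q}(x) - y` is integral. -/
def charFin (v : HeightOneSpectrum (𝓞 E)) (x : v.adicCompletion E) : ℂ :=
  Complex.exp (-(2 * Real.pi * Complex.I * (Classical.epsilon fun y : ℚ =>
    (∃ (a : ℤ) (k : ℕ), y = a / (ringChar (𝓞 E ⧸ v.asIdeal) : ℚ) ^ k) ∧
    (Algebra.trace (padicSubfield v) (v.adicCompletion E) x : v.adicCompletion E) -
      algebraMap ℚ (v.adicCompletion E) y ∈ v.adicCompletionIntegers E : ℚ)))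

theorem residue_eq_zero (v : HeightOneSpectrum (𝓞 E)) (x : v.adicCompletionIntegers E)
    (hx : Valued.v (x : v.adicCompletion E) < 1) :
    IsLocalRing.residue (v.adicCompletionIntegers E) x = 0 := by
  rw [IsLocalRing.residue_eq_zero_iff, IsLocalRing.mem_maximalIdeal, mem_nonunits_iff,
    HeightOneSpectrum.adicCompletionIntegers.isUnit_iff_valued_eq_one]
  exact hx.ne

open scoped Valued in
/-- The completion of a number field at a finite place is locally compact. -/
instance locallyCompact_adicCompletion (v : HeightOneSpectrum (𝓞 E)) :
    LocallyCompactSpace (v.adicCompletion E) := by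
  have hf : Finite (IsLocalRing.ResidueField (v.adicCompletionIntegers E)) := by
    have hq : Finite (𝓞 E ⧸ v.asIdeal) := v.asIdeal.finiteQuotientOfFreeOfNeBot v.ne_bot
    let φ : 𝓞 E →+* IsLocalRing.ResidueField (v.adicCompletionIntegers E) :=
      (IsLocalRing.residue (v.adicCompletionIntegers E)).comp
        (algebraMap (𝓞 E) (v.adicCompletionIntegers E))
    have hker : ∀ a ∈ v.asIdeal, φ a = 0 := by
      intro a ha
      apply residue_eq_zero
      rw [HeightOneSpectrum.algebraMap_adicCompletionIntegers_apply,
        HeightOneSpectrum.valuedAdicCompletion_eq_valuation']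
      exact (v.valuation_lt_one_iff_mem a).2 ha
    have hsurj : Function.Surjective φ := by
      intro y
      obtain ⟨x, rfl⟩ := IsLocalRing.residue_surjective y
      have hU : {z : v.adicCompletion E | Valued.v (z - x) < 1} ∈ nhds (x : v.adicCompletion E) :=
        (Valued.mem_nhds).2 ⟨1, fun z hz => by simpa using hz⟩
      obtain ⟨k, hk⟩ := (HeightOneSpectrum.denseRange_algebraMap (K := E) v).exists_mem_open
        isOpen_interior ⟨_, mem_interior_iff_mem_nhds.2 hU⟩
      have hk1 : Valued.v ((algebraMap E (v.adicCompletion E) k) - x) < 1 := by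
        simpa using interior_subset hk
      have hk2 : v.valuation E k ≤ 1 := by
        rw [← HeightOneSpectrum.valuedAdicCompletion_eq_valuation']
        have h := Valuation.map_add (Valued.v : Valuation (v.adicCompletion E) _)
          ((algebraMap E (v.adicCompletion E) k) - x) x
        rw [sub_add_cancel] at h
        exact h.trans (max_le hk1.le x.2)
      obtain ⟨a, ha⟩ := v.exists_valuation_sub_lt_of_integer hk2 1
      refine ⟨a, ?_⟩
      rw [← sub_eq_zero]
      change IsLocalRing.residue _ _ - _ = 0
      rw [← map_sub]
      apply residue_eq_zero
      have h1 : Valued.v (algebraMap E (v.adicCompletion E) (algebraMap (𝓞 E) E a - k)) < 1 := by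
        have := HeightOneSpectrum.valuedAdicCompletion_eq_valuation' (v := v)
          (algebraMap (𝓞 E) E a - k)
        exact this.trans_lt (by simpa using ha)
      have h2 := Valuation.map_add_lt _ h1 hk1
      rw [map_sub, sub_add_sub_cancel] at h2
      exact h2
    exact Finite.of_surjective (Ideal.Quotient.lift v.asIdeal φ hker)
      (Ideal.Quotient.lift_surjective_of_surjective _ _ hsurj)
  have hc : CompactSpace 𝒪[v.adicCompletion E] := by
    rw [Valued.integer.compactSpace_iff_completeSpace_and_isDiscreteValuationRing_and_finite_residueField]
    refine ⟨?_, ?_, hf⟩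
    · exact (Valued.isClosed_valuationSubring _).completeSpace_coe
    · exact (inferInstance : IsDiscreteValuationRing (v.adicCompletionIntegers E))
  exact IsCompact.locallyCompactSpace_of_mem_nhds_of_addGroup (isCompact_iff_compactSpace.mpr hc)
    ((Valued.isOpen_valuationSubring _).mem_nhds (zero_mem _))

end Places

/-! ### Haar measures on spaces of Hermitian matrices -/

section Haar

variable {E K : Type*} [Field E] [Field K] [Algebra E K] (ε : K ≃ₐ[E] K) (n : ℕ)
variable (R : Type*) [CommRing R] [Algebra E R] [TopologicalSpace R]

/-- The canonical topology of `Her_n(R ⊗ K)` as a (finite) `R`-module. -/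
instance : TopologicalSpace (Her ε n R) := moduleTopology R (Her ε n R)

instance : IsModuleTopology R (Her ε n R) := ⟨rfl⟩

instance : MeasurableSpace (Her ε n R) := borel _

instance : BorelSpace (Her ε n R) := ⟨rfl⟩

instance [IsTopologicalRing R] : IsTopologicalAddGroup (Her ε n R) :=
  IsModuleTopology.topologicalAddGroup R _

instance {F : Type*} [Field F] [Algebra E F] [TopologicalSpace F] [IsTopologicalRing F]
    [LocallyCompactSpace F] [Algebra.IsQuadraticExtension E K] :
    LocallyCompactSpace (Her ε n F) := by
  have : FiniteDimensional E K :=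
    Module.finite_of_finrank_eq_succ (Algebra.IsQuadraticExtension.finrank_eq_two E K)
  have : FiniteDimensional F (Her ε n F) :=
    inferInstanceAs (FiniteDimensional F (hermSubmodule ε n F))
  let e := (Module.finBasis F (Her ε n F)).equivFun
  have : ContinuousAdd (Her ε n F) := IsModuleTopology.toContinuousAdd F _
  let h : Her ε n F ≃ₜ (Fin (Module.finrank F (Her ε n F)) → F) :=
    { e.toEquiv with
      continuous_toFun := IsModuleTopology.continuous_of_linearMap e.toLinearMap
      continuous_invFun := IsModuleTopology.continuous_of_linearMap e.symm.toLinearMap }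
  exact h.isClosedEmbedding.locallyCompactSpace

variable {n}

/-- The Haar measure on `Her_n(F ⊗ K)`, `F` a locally compact field, for which `B` has measure
`1`. -/
def haarNormalized {F : Type*} [Field F] [Algebra E F] [TopologicalSpace F] [IsTopologicalRing F]
    [LocallyCompactSpace F] [Algebra.IsQuadraticExtension E K] (B : Set (Her ε n F)) :
    Measure (Her ε n F) :=
  (Measure.addHaar B)⁻¹ • Measure.addHaar

variable [NumberField E] [NumberField K]

/-- The image of `O_{E_v} ⊗ O_K` in `E_v ⊗ K`, for `v` finite. -/
def integralPart (K : Type*) [Field K] [Algebra E K] (v : HeightOneSpectrum (𝓞 E)) :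
    AddSubgroup (v.adicCompletion E ⊗[E] K) :=
  AddSubgroup.closure
    {z | ∃ a ∈ v.adicCompletionIntegers E, ∃ x : 𝓞 K, z = a ⊗ₜ[E] (x : K)}

variable (n) in
/-- The Haar measure of `Her_n(E_v ⊗ K)`, `v` finite, for which `Her_n(O_{E_v} ⊗ O_K)` has
measure `1`. -/
def measFin [Algebra.IsQuadraticExtension E K] (v : HeightOneSpectrum (𝓞 E)) :
    Measure (Her ε n (v.adicCompletion E)) :=
  haarNormalized ε {b | ∀ i j, b.mat i j ∈ integralPart K v}

theorem exists_extension (K : Type*) [Field K] [NumberField K] [Algebra E K]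
    (v : InfinitePlace E) : ∃ φ : K →+* ℂ, φ.comp (algebraMap E K) = v.embedding := by
  let := v.embedding.toAlgebra
  have : FiniteDimensional E K := Module.Finite.of_restrictScalars_finite ℚ E K
  exact ⟨(IsAlgClosed.lift (M := ℂ) (R := E) (S := K)).toRingHom, AlgHom.comp_algebraMap _⟩

/-- An embedding of `K` into `ℂ` extending the one of `E` given by `v`. -/
def embK (K : Type*) [Field K] [NumberField K] [Algebra E K] (v : InfinitePlace E) : K →+* ℂ :=
  (exists_extension K v).choose

/-- The isomorphism `E_v ⊗ K ≅ ℂ` at a real place `v` of `E` which becomes complex in `K`,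
given by one of the two extensions of `v` to an embedding of `K`. -/
def toComplex (K : Type*) [Field K] [NumberField K] [Algebra E K] (v : InfinitePlace E) :
    v.Completion ⊗[E] K →+* ℂ :=
  letI := v.embedding.toAlgebra
  (Algebra.TensorProduct.lift
    (S := E)
    { InfinitePlace.Completion.extensionEmbedding v with
      commutes' := fun x => InfinitePlace.Completion.extensionEmbedding_coe v (WithAbs.toAbs v.1 x) }
    { embK K v with
      commutes' := fun x => congrArg (fun f : E →+* ℂ => f x) (exists_extension K v).choose_spec }
    (fun _ _ => Commute.all _ _) : v.Completion ⊗[E] K →ₐ[E] ℂ).toRingHom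

variable (n) in
/-- The measure `|⋀_j dx_jj ⋀_{j<k} (2⁻¹ dx_jk ∧ dx̄_jk)|` on `Her_n(E_v ⊗ K) = Her_n(ℂ)`, `v`
infinite, that is, Lebesgue measure in the real coordinates `x_jj`, `Re x_jk` and `Im x_jk` for
`j < k`: the Haar measure for which the unit cube in these coordinates has measure `1`. It does
not change if the embedding of `K` is replaced by its conjugate. -/
def measInf [Algebra.IsQuadraticExtension E K] (v : InfinitePlace E) :
    Measure (Her ε n v.Completion) :=
  haarNormalized ε {b |
    (∀ j k, j ≤ k → (toComplex K v (b.mat j k)).re ∈ Set.Icc (0 : ℝ) 1) ∧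
    (∀ j k, j < k → (toComplex K v (b.mat j k)).im ∈ Set.Icc (0 : ℝ) 1)}

end Haar

/-! ### Siegel sections and Fourier coefficients -/

section Sections

variable {E K : Type*} [Field E] [Field K] [Algebra E K] (ε : K ≃ₐ[E] K) {n : ℕ}
variable [NumberField E] [NumberField K] [Algebra.IsQuadraticExtension E K]

/-- A Hecke character of `K`: a continuous character of `A_Kˣ` trivial on `Kˣ`. Here
`A_K = A_E ⊗[E] K` carries its topology as a finite free `A_E`-module. -/
structure HeckeChar (E K : Type*) [Field E] [Field K] [Algebra E K] [NumberField E] where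
  /-- The underlying homomorphism. -/
  toHom : (AE E ⊗[E] K)ˣ →* ℂˣ
  continuous_toHom :
    letI : TopologicalSpace (AE E ⊗[E] K) := moduleTopology (AE E) (AE E ⊗[E] K)
    Continuous toHom
  map_principal : ∀ x : Kˣ, toHom
    (Units.map ((Algebra.TensorProduct.includeRight : K →ₐ[E] AE E ⊗[E] K) : K →* _) x) = 1

/-- The component `χ_v` of `χ` at an infinite place `v` of `E`, a character of `(E_v ⊗ K)ˣ`. -/
def HeckeChar.atInf (χ : HeckeChar E K) (v : InfinitePlace E) :
    (v.Completion ⊗[E] K)ˣ →* ℂˣ :=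
  χ.toHom.comp (extendByOne K (inclInf v) (inclInf_mul v))

/-- The component `χ_v` of `χ` at a finite place `v` of `E`, a character of `(E_v ⊗ K)ˣ`. -/
def HeckeChar.atFin (χ : HeckeChar E K) (v : HeightOneSpectrum (𝓞 E)) :
    (v.adicCompletion E ⊗[E] K)ˣ →* ℂˣ :=
  χ.toHom.comp (extendByOne K (inclFin v) (inclFin_mul v))

/-- The matrix `λ h` for `λ ∈ Rˣ` and `h ∈ GL_n(R ⊗ K)`. -/
def smulGL {R : Type*} [CommRing R] [Algebra E R] (l : Rˣ) (h : GL (Fin n) (R ⊗[E] K)) :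
    GL (Fin n) (R ⊗[E] K) :=
  Units.map (algebraMap R (Matrix (Fin n) (Fin n) (R ⊗[E] K)) : R →* _) l * h

/-- The element `ᵗh̄` of `GL_n(R ⊗ K)`. -/
def ctGL {R : Type*} [CommRing R] [Algebra E R] (h : GL (Fin n) (R ⊗[E] K)) :
    GL (Fin n) (R ⊗[E] K) :=
  ⟨ct ε h.val, ct ε (h⁻¹).val, by rw [← ct_mul, ← Units.val_mul]; simp [ct_one],
    by rw [← ct_mul, ← Units.val_mul]; simp [ct_one]⟩

/-- `f ∈ Ind_{GP(E_v)}^{GU(E_v)}(χ_v, s)`, where `F = E_v`: for `p = diag(ᵗh̄⁻¹, λh) (1, b; 0, 1)`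
in the Siegel parabolic subgroup, `f(pg) = χ_v(det(λh)) |a ā|_v^{-s} f(g)` with `a = det(λh)`. -/
def IsLocalSection {F : Type*} [NormedField F] [Algebra E F] (χ : (F ⊗[E] K)ˣ →* ℂˣ) (s : ℂ)
    (f : GU ε n F → ℂ) : Prop :=
  ∀ (h : GL (Fin n) (F ⊗[E] K)) (l : Fˣ) (b : Her ε n F) (g : GU ε n F),
    f (mGU ε h l * nGU ε b * g) =
      (χ (Matrix.GeneralLinearGroup.det (smulGL l h)) : ℂ) *
      ((‖toBase ((smulGL l h).val.det * conj ε F (smulGL l h).val.det)‖ : ℝ) : ℂ) ^ (-s) * f g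

variable (n) in
/-- A factorizable Siegel section `f = ⊗_v f_v` in `Ind_{GP}^{GU}(χ, s)`, given by its local
components at the places of `E`. -/
structure SiegelSection (χ : HeckeChar E K) (s : ℂ) where
  /-- The components at the infinite places. -/
  atInf : (v : InfinitePlace E) → GU ε n v.Completion → ℂ
  /-- The components at the finite places. -/
  atFin : (v : HeightOneSpectrum (𝓞 E)) → GU ε n (v.adicCompletion E) → ℂ
  isLocalSection_atInf : ∀ v, IsLocalSection ε (χ.atInf v) s (atInf v)
  isLocalSection_atFin : ∀ v, IsLocalSection ε (χ.atFin v) s (atFin v)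

variable {χ : HeckeChar E K} {s : ℂ} {ε}

/-- The integrand `f_v(η (1, b; 0, 1) g_v) e_v(-tr(β_v b))`, `v` infinite. -/
def integrandInf (β : Matrix (Fin n) (Fin n) (AE E ⊗[E] K)) (g : GU ε n (AE E))
    (f : SiegelSection ε n χ s) (v : InfinitePlace E) (b : Her ε n v.Completion) : ℂ :=
  f.atInf v (etaGU ε * nGU ε b * GU.map ε (compInf v) g) *
    charInf v (-toBase ((β.map (baseMap (compInf v) K) * b.mat).trace))

/-- The integrand `f_v(η (1, b; 0, 1) g_v) e_v(-tr(β_v b))`, `v` finite. -/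
def integrandFin (β : Matrix (Fin n) (Fin n) (AE E ⊗[E] K)) (g : GU ε n (AE E))
    (f : SiegelSection ε n χ s) (v : HeightOneSpectrum (𝓞 E))
    (b : Her ε n (v.adicCompletion E)) : ℂ :=
  f.atFin v (etaGU ε * nGU ε b * GU.map ε (compFin v) g) *
    charFin v (-toBase ((β.map (baseMap (compFin v) K) * b.mat).trace))

/-- The local coefficient `c_v(β, g; f)` at an infinite place. -/
def coeffInf (β : Matrix (Fin n) (Fin n) (AE E ⊗[E] K)) (g : GU ε n (AE E))
    (f : SiegelSection ε n χ s) (v : InfinitePlace E) : ℂ :=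
  ∫ b, integrandInf β g f v b ∂(measInf ε n v)

/-- The local coefficient `c_v(β, g; f)` at a finite place. -/
def coeffFin (β : Matrix (Fin n) (Fin n) (AE E ⊗[E] K)) (g : GU ε n (AE E))
    (f : SiegelSection ε n χ s) (v : HeightOneSpectrum (𝓞 E)) : ℂ :=
  ∫ b, integrandFin β g f v b ∂(measFin ε n v)

/-- The constant `C(n, K) = 2^{n(n-1)[E:ℚ]/2} |D_E|^{-n/2} |D_K|^{-n(n-1)/4}`. -/
def constC (E K : Type*) [Field E] [NumberField E] [Field K] [NumberField K] (n : ℕ) : ℝ :=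
  (2 : ℝ) ^ ((n : ℝ) * (n - 1) * Module.finrank ℚ E / 2) *
    |(discr E : ℝ)| ^ (-(n : ℝ) / 2) * |(discr K : ℝ)| ^ (-((n : ℝ) * (n - 1)) / 4)

/-- The (global) coefficient `c(β, g; f) = C(n, K) ∏_v c_v(β_v, g_v; f_v)`, for an adelic
Hermitian matrix `β` and `g ∈ GU(η)(A_E)`. -/
def fourierCoeff (β : Matrix (Fin n) (Fin n) (AE E ⊗[E] K)) (g : GU ε n (AE E))
    (f : SiegelSection ε n χ s) : ℂ :=
  constC E K n * ((∏ v, coeffInf β g f v) * ∏' v, coeffFin β g f v)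

/-- The integrals and the product defining `c(β, g; f)` converge. -/
def CoeffConverges (β : Matrix (Fin n) (Fin n) (AE E ⊗[E] K)) (g : GU ε n (AE E))
    (f : SiegelSection ε n χ s) : Prop :=
  (∀ v, Integrable (integrandInf β g f v) (measInf ε n v)) ∧
  (∀ v, Integrable (integrandFin β g f v) (measFin ε n v)) ∧
  Multipliable (coeffFin β g f)

variable (E) in
/-- A matrix over `K` viewed as a matrix over `A_K = A_E ⊗ K`. -/
def adelicMat (β : Matrix (Fin n) (Fin n) K) : Matrix (Fin n) (Fin n) (AE E ⊗[E] K) :=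
  β.map (Algebra.TensorProduct.includeRight : K →ₐ[E] AE E ⊗[E] K)

end Sections

end SiegelSim

end

/-! The theorem is a change of variables at each place. Write m for the Levi element of h and λ, and
n(b) for the unipotent element of b. Then η n(b) m = m' η n(b'), where b' = λ ᵗh̄ b h and m' is the
Levi element of (λ ᵗh̄)⁻¹ and λ (`etaGU_mul_nGU_mul_mGU`). Put N = det(ᵗh̄⁻¹ h⁻¹). Pulling m' out of
f_v produces χ_v(det ᵗh̄⁻¹) |N|_v^{-s}. Cyclicity of the trace gives tr(β b) = tr(β' b') with β' =
λ⁻¹ h⁻¹ β ᵗh̄⁻¹. The substitution b ↦ b' contributes the inverse of its modulus, |λ|_v^{-n²}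
|N|_v^n. The product of these is `localFactor`; see `integrable_and_integral_local`.

The modulus rests on two facts. First, b ↦ b' has determinant λ^{n²} det(ᵗh̄ h)^n (`det_hermTwist`):
extending scalars from E_v to E_v ⊗ K turns Hermitian matrices into all matrices, where the map is M
↦ λ ᵗh̄ M h. Second, a linear automorphism scales Haar measure by |det|_v⁻¹ under push-forward
(`map_linearEquiv_addHaar`). Elementary matrices reduce this to dimension one, where it is Lebesgue
measure on ℝ at a real place and a count of residue classes at a finite one.

Globally, the local factors multiply to the stated factor because |·|_E is a product by definition
and χ is the product of its local components (`HeckeChar.eq_prod`). The latter follows from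
continuity: ℂˣ has no small subgroups, so χ is trivial on units of A_K that are 1 at enough places
and integral, together with their inverses, at the others. All local factors are nonzero and almost
all are 1, so convergence passes in both directions. -/

noncomputable section

namespace SiegelSim

/-! ### Coordinates on `R ⊗ K`: the decomposition R ⊕ R δ with δ̄ = -δ -/

section Algebra

variable {E K : Type*} [Field E] [Field K] [Algebra E K] {ε : K ≃ₐ[E] K} {n : ℕ}
variable {R : Type*} [CommRing R] [Algebra E R]

theorem algebraMap_tensor_injective : Function.Injective (algebraMap R (R ⊗[E] K)) :=
  Algebra.TensorProduct.includeLeft_injective (S := R) (algebraMap E K).injective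

theorem toBase_algebraMap (a : R) : toBase (algebraMap R (R ⊗[E] K) a) = a :=
  Function.leftInverse_invFun algebraMap_tensor_injective a

theorem conj_smul_tmul {δ : K} (hδ : ε δ = -δ) (b : R) :
    conj ε R (b • (1 : R) ⊗ₜ[E] δ) = -(b • (1 : R) ⊗ₜ[E] δ) := by
  rw [map_smul]
  simp [conj, hδ, TensorProduct.tmul_neg]

theorem conj_det {m : Type*} [Fintype m] [DecidableEq m] (M : Matrix m m (R ⊗[E] K)) :
    conj ε R M.det = (ct ε M).det := by
  rw [ct, Matrix.det_transpose, ← AlgHom.mapMatrix_apply, ← AlgHom.map_det]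

theorem smul_tmul_injective {δ : K} (h0 : δ ≠ 0) {b : R} (h : b • (1 : R) ⊗ₜ[E] δ = 0) :
    b = 0 := by
  have h1 := congrArg (fun z => z * (1 : R) ⊗ₜ[E] δ⁻¹) h
  simp only [zero_mul, smul_mul_assoc, Algebra.TensorProduct.tmul_mul_tmul, mul_one,
    mul_inv_cancel₀ h0] at h1
  apply algebraMap_tensor_injective (E := E) (K := K)
  rw [map_zero, Algebra.algebraMap_eq_smul_one]
  exact h1

theorem eq_zero_of_add_self_eq_zero [CharZero E] {M : Type*} [AddCommGroup M] [Module E M] {z : M}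
    (h : z + z = 0) : z = 0 := by
  have h2 : (2 : E) • z = 0 := by rw [two_smul, h]
  have : (2 : E)⁻¹ • ((2 : E) • z) = 0 := by rw [h2, smul_zero]
  rwa [smul_smul, inv_mul_cancel₀ two_ne_zero, one_smul] at this

/-- Adding the conjugate relation cancels the δ-part and leaves 2a = 0, and 2 is invertible because
E has characteristic zero; then bδ = 0 and δ is a unit. -/
theorem algebraMap_add_smul_tmul_eq_zero [CharZero E] {δ : K} (h0 : δ ≠ 0) (hδ : ε δ = -δ)
    {a b : R} (h : algebraMap R (R ⊗[E] K) a + b • (1 : R) ⊗ₜ[E] δ = 0) : a = 0 ∧ b = 0 := by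
  have h1 := congrArg (conj ε R) h
  rw [map_add, AlgHom.commutes, conj_smul_tmul hδ, map_zero] at h1
  have ha : algebraMap R (R ⊗[E] K) a = 0 :=
    eq_zero_of_add_self_eq_zero (E := E) (by linear_combination h + h1)
  refine ⟨algebraMap_tensor_injective (ha.trans (map_zero _).symm), ?_⟩
  rw [ha, zero_add] at h
  exact smul_tmul_injective h0 h

theorem algebraMap_add_smul_tmul_inj [CharZero E] {δ : K} (h0 : δ ≠ 0) (hδ : ε δ = -δ)
    {a b a' b' : R} (h : algebraMap R (R ⊗[E] K) a + b • (1 : R) ⊗ₜ[E] δ =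
      algebraMap R (R ⊗[E] K) a' + b' • (1 : R) ⊗ₜ[E] δ) : a = a' ∧ b = b' := by
  have := algebraMap_add_smul_tmul_eq_zero (R := R) h0 hδ (a := a - a') (b := b - b')
    (by rw [map_sub, sub_smul]; linear_combination h)
  exact ⟨sub_eq_zero.1 this.1, sub_eq_zero.1 this.2⟩

variable [Algebra.IsQuadraticExtension E K]

theorem aut_apply_apply (x : K) : ε (ε x) = x :=
  congrArg (fun e : K ≃ₐ[E] K => e x) (aut_mul_self ε)

/-- An extension of degree 2 has no proper intermediate field, so the fixed field of ε is E or K,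
and K would force ε = 1. -/
theorem exists_algebraMap_eq_of_fixed (hε : ε ≠ 1) {x : K} (hx : ε x = x) :
    ∃ a : E, algebraMap E K a = x := by
  have h2 : Module.finrank E K = 2 := Algebra.IsQuadraticExtension.finrank_eq_two E K
  have := IntermediateField.isSimpleOrder_of_finrank_prime E K (h2 ▸ Nat.prime_two)
  rcases eq_bot_or_eq_top (IntermediateField.fixedField (Subgroup.zpowers ε)) with h | h
  · refine IntermediateField.mem_bot.1 (h ▸ ?_)
    rw [IntermediateField.mem_fixedField_iff]
    have hle : Subgroup.zpowers ε ≤ MulAction.stabilizer (K ≃ₐ[E] K) x :=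
      Subgroup.zpowers_le.2 hx
    exact fun f hf => hle hf
  · refine absurd (AlgEquiv.ext fun y => ?_) hε
    have hy : y ∈ IntermediateField.fixedField (Subgroup.zpowers ε) := h ▸ trivial
    exact (IntermediateField.mem_fixedField_iff _ _).1 hy ε (Subgroup.mem_zpowers ε)

variable (ε) in
-- Any ε x - x with x not fixed will do. Such a δ gives the basis 1, δ of K over E in which all
-- computations in `R ⊗ K` are made.
theorem exists_antiinvariant (hε : ε ≠ 1) : ∃ δ : K, δ ≠ 0 ∧ ε δ = -δ := by
  obtain ⟨x, hx⟩ : ∃ x, ε x ≠ x := by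
    by_contra! h
    exact hε (AlgEquiv.ext h)
  exact ⟨ε x - x, sub_ne_zero.2 hx, by rw [map_sub, aut_apply_apply, neg_sub]⟩

variable [CharZero E]

theorem exists_eq_algebraMap_add (hε : ε ≠ 1) {δ : K} (h0 : δ ≠ 0) (hδ : ε δ = -δ)
    (z : R ⊗[E] K) :
    ∃ a b : R, z = algebraMap R (R ⊗[E] K) a + b • (1 : R) ⊗ₜ[E] δ := by
  have : CharZero K := charZero_of_injective_algebraMap (algebraMap E K).injective
  have h2 : ε 2 = 2 := map_ofNat ε 2
  induction z with
  | zero => exact ⟨0, 0, by simp⟩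
  | add x y hx hy =>
    obtain ⟨a, b, rfl⟩ := hx
    obtain ⟨a', b', rfl⟩ := hy
    exact ⟨a + a', b + b', by rw [map_add, add_smul]; abel⟩
  | tmul r k =>
    -- The coordinates of k are its ε-invariant half and its anti-invariant half divided by δ; both
    -- are fixed by ε, hence lie in E.
    obtain ⟨a, ha⟩ := exists_algebraMap_eq_of_fixed hε (x := (k + ε k) / 2)
      (by simp [aut_apply_apply, add_comm, h2])
    obtain ⟨b, hb⟩ := exists_algebraMap_eq_of_fixed hε (x := (k - ε k) / (2 * δ))
      (by simp [aut_apply_apply, hδ, h2]; rw [← neg_sub, neg_div_neg_eq])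
    refine ⟨a • r, b • r, ?_⟩
    have hk : k = a • (1 : K) + b • δ := by
      rw [Algebra.smul_def, Algebra.smul_def, ha, hb]; field_simp; ring
    rw [Algebra.TensorProduct.algebraMap_apply, TensorProduct.smul_tmul', smul_eq_mul, mul_one,
      Algebra.algebraMap_self_apply]
    conv_lhs => rw [hk]
    rw [TensorProduct.tmul_add, TensorProduct.tmul_smul, TensorProduct.tmul_smul,
      TensorProduct.smul_tmul', TensorProduct.smul_tmul']

/-- The elements of `R ⊗ K` fixed by the involution come from `R`. -/
theorem exists_algebraMap_eq_of_conj_eq (hε : ε ≠ 1) {z : R ⊗[E] K} (hz : conj ε R z = z) :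
    ∃ a : R, algebraMap R (R ⊗[E] K) a = z := by
  obtain ⟨δ, h0, hδ⟩ := exists_antiinvariant ε hε
  obtain ⟨a, b, rfl⟩ := exists_eq_algebraMap_add (R := R) hε h0 hδ z
  rw [map_add, AlgHom.commutes, conj_smul_tmul hδ] at hz
  have : b • (1 : R) ⊗ₜ[E] δ = 0 :=
    eq_zero_of_add_self_eq_zero (E := E) (by linear_combination -hz)
  exact ⟨a, by rw [this, add_zero]⟩

theorem algebraMap_toBase (hε : ε ≠ 1) {z : R ⊗[E] K} (hz : conj ε R z = z) :
    algebraMap R (R ⊗[E] K) (toBase z) = z := by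
  obtain ⟨a, rfl⟩ := exists_algebraMap_eq_of_conj_eq hε hz
  rw [toBase_algebraMap]

end Algebra

/-! ### The substitution b ↦ λ ᵗh̄ b h on Hermitian matrices -/

section Twist

variable {E K : Type*} [Field E] [Field K] [Algebra E K] {ε : K ≃ₐ[E] K} {n : ℕ}
variable {R : Type*} [CommRing R] [Algebra E R]

@[ext] theorem Her.ext {b c : Her ε n R} (h : b.mat = c.mat) : b = c := Subtype.ext h

theorem smulGL_val (l : Rˣ) (h : GL (Fin n) (R ⊗[E] K)) :
    (smulGL l h).val = (l : R) • h.val := by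
  rw [smulGL, Units.val_mul, Units.coe_map, MonoidHom.coe_coe, Algebra.smul_def]

/-- The scalar cancels: when the Levi element of (λ ᵗh̄)⁻¹ and λ is fed to a Siegel section, the
matrix whose determinant is taken is ᵗh̄⁻¹, with no λ left. -/
theorem smulGL_inv_smulGL_ctGL (h : GL (Fin n) (R ⊗[E] K)) (l : Rˣ) :
    smulGL l (smulGL l (ctGL ε h))⁻¹ = ctGL ε h⁻¹ := by
  have : ctGL ε h⁻¹ = (ctGL ε h)⁻¹ := rfl
  set u : GL (Fin n) (R ⊗[E] K) :=
    Units.map (algebraMap R (Matrix (Fin n) (Fin n) (R ⊗[E] K)) : R →* _) l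
  have hu : u * (ctGL ε h)⁻¹ = (ctGL ε h)⁻¹ * u := Units.ext (Algebra.commutes _ _)
  rw [this, smulGL, smulGL, mul_inv_rev, ← mul_assoc, hu, mul_inv_cancel_right]

theorem nGU_zero : nGU ε (0 : Her ε n R) = 1 := by
  apply Subtype.ext
  apply Units.ext
  change Matrix.fromBlocks 1 0 0 1 = 1
  rw [Matrix.fromBlocks_one]

variable [Algebra.IsQuadraticExtension E K]

/-- The map `b ↦ l ᵗh̄ b h` on Hermitian matrices. -/
def hermTwistHom (h : Matrix (Fin n) (Fin n) (R ⊗[E] K)) (l : R) :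
    Her ε n R →ₗ[R] Her ε n R where
  toFun b := ⟨l • (ct ε h * b.mat * h), by
    change ct ε _ = _
    rw [ct_smul, ct_mul, ct_mul, b.ct_mat, ct_ct, Matrix.mul_assoc]⟩
  map_add' b c := Her.ext <| by
    change l • (ct ε h * (b.mat + c.mat) * h) = l • (ct ε h * b.mat * h) + l • (ct ε h * c.mat * h)
    rw [Matrix.mul_add, Matrix.add_mul, smul_add]
  map_smul' r b := Her.ext <| by
    change l • (ct ε h * (r • b.mat) * h) = r • l • (ct ε h * b.mat * h)
    rw [Matrix.mul_smul, Matrix.smul_mul, smul_comm]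

theorem hermTwistHom_mat (h : Matrix (Fin n) (Fin n) (R ⊗[E] K)) (l : R) (b : Her ε n R) :
    (hermTwistHom h l b).mat = l • (ct ε h * b.mat * h) := rfl

theorem hermTwistHom_comp (h h' : Matrix (Fin n) (Fin n) (R ⊗[E] K)) (l l' : R) :
    (hermTwistHom h l : Her ε n R →ₗ[R] Her ε n R) ∘ₗ hermTwistHom h' l' =
      hermTwistHom (h' * h) (l * l') := by
  ext b : 2
  simp only [LinearMap.comp_apply, hermTwistHom_mat, Matrix.mul_smul, Matrix.smul_mul, smul_smul,
    ct_mul, Matrix.mul_assoc]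

theorem hermTwistHom_one :
    (hermTwistHom (1 : Matrix (Fin n) (Fin n) (R ⊗[E] K)) 1 : Her ε n R →ₗ[R] Her ε n R) =
      LinearMap.id := by
  ext b : 2
  simp [hermTwistHom_mat, ct_one]

variable (ε) in
/-- The automorphism `b ↦ l ᵗh̄ b h` of the space of Hermitian matrices. -/
def hermTwist (h : GL (Fin n) (R ⊗[E] K)) (l : Rˣ) : Her ε n R ≃ₗ[R] Her ε n R :=
  LinearEquiv.ofLinearMap (hermTwistHom h.val l) (hermTwistHom (h⁻¹).val ((l⁻¹ : Rˣ) : R))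
    (by rw [hermTwistHom_comp, ← Units.val_mul, ← Units.val_mul]; simp [hermTwistHom_one])
    (by rw [hermTwistHom_comp, ← Units.val_mul, ← Units.val_mul]; simp [hermTwistHom_one])

theorem hermTwist_mat (h : GL (Fin n) (R ⊗[E] K)) (l : Rˣ) (b : Her ε n R) :
    (hermTwist ε h l b).mat = (l : R) • (ct ε h.val * b.mat * h.val) := rfl

/-- Moving a Levi element across `η` and a unipotent element. -/
theorem etaGU_mul_nGU_mul_mGU (h : GL (Fin n) (R ⊗[E] K)) (l : Rˣ) (b : Her ε n R) :
    etaGU ε * nGU ε b * mGU ε h l =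
      mGU ε (smulGL l (ctGL ε h))⁻¹ l * nGU ε 0 * (etaGU ε * nGU ε (hermTwist ε h l b)) := by
  -- The trivial unipotent factor in the statement only serves to match the shape of
  -- `IsLocalSection`.
  rw [nGU_zero, mul_one]
  apply Subtype.ext
  apply Units.ext
  have h1 : ct ε h⁻¹.val * ct ε h.val = 1 := by rw [← ct_mul, ← Units.val_mul]; simp [ct_one]
  have h2 : ((l : R) • ((smulGL l (ctGL ε h))⁻¹).val) = ct ε h⁻¹.val := by
    rw [← smulGL_val, smulGL_inv_smulGL_ctGL]; rfl
  change Matrix.fromBlocks 0 (-1) 1 0 * Matrix.fromBlocks 1 b.mat 0 1 *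
    Matrix.fromBlocks (ct ε (h⁻¹).val) 0 0 ((l : R) • h.val) =
    Matrix.fromBlocks (ct ε (((smulGL l (ctGL ε h))⁻¹)⁻¹).val) 0 0
      ((l : R) • ((smulGL l (ctGL ε h))⁻¹).val) *
    (Matrix.fromBlocks 0 (-1) 1 0 * Matrix.fromBlocks 1 (hermTwist ε h l b).mat 0 1)
  rw [h2, inv_inv, smulGL_val, ct_smul, hermTwist_mat]
  have h3 : ct ε (ctGL ε h).val = h.val := ct_ct _
  simp [Matrix.fromBlocks_multiply, h3, ← Matrix.mul_assoc, h1, -Matrix.coe_units_inv]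

end Twist

/-! ### The determinant of the substitution -/

open scoped Kronecker in
-- Stacking the columns of M turns M ↦ X M Y into the Kronecker product Yᵀ ⊗ X, whose determinant is
-- known.
theorem det_mulLeft_mulRight {A : Type*} [CommRing A] {n : Type*} [Fintype n] [DecidableEq n]
    (X Y : Matrix n n A) :
    LinearMap.det
        (LinearMap.mulRight A Y ∘ₗ LinearMap.mulLeft A X : Matrix n n A →ₗ[A] Matrix n n A) =
      X.det ^ Fintype.card n * Y.det ^ Fintype.card n := by
  let e : Matrix n n A ≃ₗ[A] (n × n → A) :=
    { toFun := Matrix.vec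
      invFun := fun v => Matrix.of fun i j => v (j, i)
      left_inv := fun _ => rfl
      right_inv := fun _ => rfl
      map_add' := fun _ _ => rfl
      map_smul' := fun _ _ => rfl }
  have key : (e : Matrix n n A →ₗ[A] _) ∘ₗ (LinearMap.mulRight A Y ∘ₗ LinearMap.mulLeft A X) ∘ₗ
      (e.symm : _ →ₗ[A] Matrix n n A) = Matrix.toLin' (Yᵀ ⊗ₖ X) := by
    apply LinearMap.ext
    intro v
    obtain ⟨M, rfl⟩ := e.surjective v
    simp only [LinearMap.comp_apply, LinearEquiv.coe_coe, LinearEquiv.symm_apply_apply,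
      Matrix.toLin'_apply]
    refine Eq.trans ?_ (Matrix.kronecker_mulVec_vec X M Yᵀ).symm
    rw [Matrix.transpose_transpose]; rfl
  rw [← LinearMap.det_conj _ e, key, LinearMap.det_toLin', Matrix.det_kronecker,
    Matrix.det_transpose, mul_comm]

section TwistDet

variable {E K : Type*} [Field E] [Field K] [Algebra E K] {ε : K ≃ₐ[E] K} {n : ℕ}
variable {R : Type*} [CommRing R] [Algebra E R]

variable (ε n R) in
/-- The map `(R ⊗ K) ⊗ Her_n(R ⊗ K) → M_n(R ⊗ K)`. -/
def hermToMatrix : (R ⊗[E] K) ⊗[R] Her ε n R →ₗ[R ⊗[E] K] Matrix (Fin n) (Fin n) (R ⊗[E] K) :=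
  TensorProduct.AlgebraTensorModule.lift
    (LinearMap.toSpanSingleton (R ⊗[E] K) _ (hermSubmodule ε n R).subtype)

theorem hermToMatrix_tmul (a : R ⊗[E] K) (b : Her ε n R) :
    hermToMatrix ε n R (a ⊗ₜ[R] b) = a • b.mat := rfl

theorem ct_tensor_smul {m : Type*} (a : R ⊗[E] K) (M : Matrix m m (R ⊗[E] K)) :
    ct ε (a • M) = conj ε R a • ct ε M := by
  ext i j; simp [ct]

theorem ct_add {m : Type*} (M N : Matrix m m (R ⊗[E] K)) :
    ct ε (M + N) = ct ε M + ct ε N := by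
  ext i j; simp [ct]

theorem ct_sub {m : Type*} (M N : Matrix m m (R ⊗[E] K)) :
    ct ε (M - N) = ct ε M - ct ε N := by
  ext i j; simp [ct]

theorem conj_one_tmul {δ : K} (hδ : ε δ = -δ) :
    conj ε R ((1 : R) ⊗ₜ[E] δ) = -((1 : R) ⊗ₜ[E] δ) := by
  simpa using conj_smul_tmul (R := R) hδ 1

variable [CharZero E] [Algebra.IsQuadraticExtension E K]

theorem exists_eq_one_tmul_add (hε : ε ≠ 1) {δ : K} (h0 : δ ≠ 0) (hδ : ε δ = -δ)
    (t : (R ⊗[E] K) ⊗[R] Her ε n R) :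
    ∃ p q : Her ε n R, t = 1 ⊗ₜ p + ((1 : R) ⊗ₜ[E] δ) ⊗ₜ[R] q := by
  induction t with
  | zero => exact ⟨0, 0, by simp⟩
  | add x y hx hy =>
    obtain ⟨a, b, rfl⟩ := hx
    obtain ⟨a', b', rfl⟩ := hy
    exact ⟨a + a', b + b', by rw [TensorProduct.tmul_add, TensorProduct.tmul_add]; abel⟩
  | tmul z b =>
    obtain ⟨x, y, rfl⟩ := exists_eq_algebraMap_add (R := R) hε h0 hδ z
    refine ⟨x • b, y • b, ?_⟩
    rw [TensorProduct.add_tmul, Algebra.algebraMap_eq_smul_one, TensorProduct.smul_tmul,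
      TensorProduct.smul_tmul]

/-- Every matrix is uniquely p + δ q with p and q Hermitian, namely p = (M + ᵗM̄)/2 and q = δ⁻¹(M -
ᵗM̄)/2. So `Her` is a form of the full matrix module over R. -/
theorem hermToMatrix_bijective (hε : ε ≠ 1) : Function.Bijective (hermToMatrix ε n R) := by
  obtain ⟨δ, h0, hδ⟩ := exists_antiinvariant ε hε
  have hδ1 : ((1 : R) ⊗ₜ[E] δ⁻¹) * ((1 : R) ⊗ₜ[E] δ) = 1 := by
    rw [Algebra.TensorProduct.tmul_mul_tmul, mul_one, inv_mul_cancel₀ h0]; rfl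
  have hδ' : ε δ⁻¹ = -δ⁻¹ := by rw [map_inv₀, hδ, inv_neg]
  constructor
  · rw [injective_iff_map_eq_zero]
    intro t ht
    obtain ⟨p, q, rfl⟩ := exists_eq_one_tmul_add hε h0 hδ t
    rw [map_add, hermToMatrix_tmul, hermToMatrix_tmul, one_smul] at ht
    have h1 := congrArg (ct ε) ht
    rw [ct_add, ct_tensor_smul, p.ct_mat, q.ct_mat, conj_one_tmul hδ, ct_zero] at h1
    have hp : p.mat = 0 := eq_zero_of_add_self_eq_zero (E := E) (by
      rw [neg_smul] at h1
      calc p.mat + p.mat = (p.mat + ((1 : R) ⊗ₜ[E] δ) • q.mat) +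
            (p.mat + -(((1 : R) ⊗ₜ[E] δ) • q.mat)) := by abel
        _ = 0 := by rw [ht, h1, add_zero])
    rw [hp, zero_add] at ht
    have hq : q.mat = 0 := by
      rw [← one_smul (R ⊗[E] K) q.mat, ← hδ1, mul_smul, ht, smul_zero]
    have hp' : p = 0 := Her.ext hp
    have hq' : q = 0 := Her.ext hq
    rw [hp', hq', TensorProduct.tmul_zero, TensorProduct.tmul_zero, add_zero]
  · intro M
    let p : Her ε n R := ⟨(2 : E)⁻¹ • (M + ct ε M), by
      change ct ε _ = _
      rw [← algebraMap_smul R, ct_smul, ct_add, ct_ct, add_comm]⟩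
    let q : Her ε n R := ⟨(2 : E)⁻¹ • (((1 : R) ⊗ₜ[E] δ⁻¹) • (M - ct ε M)), by
      change ct ε _ = _
      rw [← algebraMap_smul R, ct_smul, ct_tensor_smul, ct_sub, ct_ct, conj_one_tmul hδ',
        neg_smul, ← smul_neg, neg_sub]⟩
    refine ⟨1 ⊗ₜ p + ((1 : R) ⊗ₜ[E] δ) ⊗ₜ[R] q, ?_⟩
    rw [map_add, hermToMatrix_tmul, hermToMatrix_tmul, one_smul]
    change (2 : E)⁻¹ • (M + ct ε M) +
      ((1 : R) ⊗ₜ[E] δ) • (2 : E)⁻¹ • (((1 : R) ⊗ₜ[E] δ⁻¹) • (M - ct ε M)) = M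
    rw [smul_comm ((1 : R) ⊗ₜ[E] δ) (2 : E)⁻¹, smul_smul, mul_comm, hδ1, one_smul, ← smul_add,
      add_add_sub_cancel, ← two_smul E, smul_smul, inv_mul_cancel₀ two_ne_zero, one_smul]

/-- A determinant survives extension of scalars, and over F ⊗ K the twist becomes M ↦ (λ ᵗh̄) M h on
all matrices. The scalar λ contributes λ^n to det(λ ᵗh̄), which is then raised to the power n. -/
theorem algebraMap_det_hermTwist {F : Type*} [Field F] [Algebra E F] (hε : ε ≠ 1)
    (h : GL (Fin n) (F ⊗[E] K)) (l : Fˣ) :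
    algebraMap F (F ⊗[E] K) (LinearMap.det (hermTwist ε h l : Her ε n F →ₗ[F] Her ε n F)) =
      algebraMap F (F ⊗[E] K) l ^ n ^ 2 * (ct ε h.val * h.val).det ^ n := by
  have : FiniteDimensional E K :=
    Module.finite_of_finrank_eq_succ (Algebra.IsQuadraticExtension.finrank_eq_two E K)
  have : FiniteDimensional F (Her ε n F) :=
    inferInstanceAs (FiniteDimensional F (hermSubmodule ε n F))
  let e := LinearEquiv.ofBijective (hermToMatrix ε n F) (hermToMatrix_bijective hε)
  have key : (e : _ →ₗ[F ⊗[E] K] _) ∘ₗ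
      (LinearMap.baseChange (F ⊗[E] K) (hermTwist ε h l : Her ε n F →ₗ[F] Her ε n F)) ∘ₗ
      (e.symm : _ →ₗ[F ⊗[E] K] _) = LinearMap.mulRight _ h.val ∘ₗ
        LinearMap.mulLeft _ (algebraMap F (F ⊗[E] K) l • ct ε h.val) := by
    apply LinearMap.ext
    intro v
    obtain ⟨M, rfl⟩ := e.surjective v
    simp only [LinearMap.comp_apply, LinearEquiv.coe_coe, LinearEquiv.symm_apply_apply,
      LinearMap.mulRight_apply, LinearMap.mulLeft_apply]
    change hermToMatrix ε n F _ = _ * hermToMatrix ε n F _ * _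
    induction M with
    | zero => simp
    | add x y hx hy => simp only [map_add, hx, hy, mul_add, add_mul]
    | tmul a b =>
      rw [LinearMap.baseChange_tmul, hermToMatrix_tmul, hermToMatrix_tmul, LinearEquiv.coe_coe,
        hermTwist_mat, algebraMap_smul]
      simp only [Matrix.mul_smul, Matrix.smul_mul, smul_comm a (l : F)]
  rw [← LinearMap.det_baseChange, ← LinearMap.det_conj _ e, key, det_mulLeft_mulRight,
    Matrix.det_smul, Matrix.det_mul, Fintype.card_fin]
  ring

/-- The determinant of `b ↦ l ᵗh̄ b h` on the space of Hermitian matrices. -/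
theorem det_hermTwist {F : Type*} [Field F] [Algebra E F] (hε : ε ≠ 1)
    (h : GL (Fin n) (F ⊗[E] K)) (l : Fˣ) :
    LinearMap.det (hermTwist ε h l : Her ε n F →ₗ[F] Her ε n F) =
      (l : F) ^ n ^ 2 * toBase (ct ε h.val * h.val).det ^ n := by
  apply algebraMap_tensor_injective (E := E) (K := K)
  rw [algebraMap_det_hermTwist hε, map_mul, map_pow, map_pow, algebraMap_toBase hε]
  rw [conj_det, ct_mul, ct_ct]

end TwistDet

/-! ### Linear automorphisms and Haar measure over a locally compact field -/

section Modulus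

open Measure Set
open scoped ENNReal

variable {ι : Type*} [Fintype ι] [DecidableEq ι]

theorem continuous_toLin'_matrix {F : Type*} [NormedField F] (M : Matrix ι ι F) :
    Continuous (Matrix.toLin' M) :=
  LinearMap.continuous_on_pi _

variable {F : Type*} [NormedField F] [LocallyCompactSpace F] [SecondCountableTopology F]
  [MeasurableSpace F] [BorelSpace F]

variable (F) in
/-- The absolute value of `F` is the modulus with respect to the Haar measure. -/
def NormIsModulus : Prop :=
  ∀ a : F, a ≠ 0 → map (fun x => a * x) (addHaar : Measure F) = ‖a‖ₑ⁻¹ • addHaar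

/-- A transvection adds to one coordinate a multiple of another one. Integrating over that
coordinate first, translation invariance of Haar measure on F shows that nothing changes. -/
theorem map_transvection_pi (t : Matrix.TransvectionStruct ι F) :
    map (Matrix.toLin' t.toMatrix) (Measure.pi fun _ : ι => (addHaar : Measure F)) =
      Measure.pi fun _ => addHaar := by
  have ht : Measurable (Matrix.toLin' t.toMatrix) := (continuous_toLin'_matrix _).measurable
  refine (pi_eq fun s hs => ?_).symm
  have h2s : MeasurableSet (univ.pi s) := .pi countable_univ fun i _ => hs i
  simp_rw [← pi_pi, ← lintegral_indicator_one h2s]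
  rw [lintegral_map (measurable_one.indicator h2s) ht]
  refine lintegral_eq_of_lmarginal_eq {t.i} ((measurable_one.indicator h2s).comp ht)
    (measurable_one.indicator h2s) ?_
  simp_rw [lmarginal_singleton]
  ext x
  cases t with | mk t_i t_j t_hij t_c =>
  simp [Matrix.transvection, Matrix.single_mulVec, t_hij.symm, ← Function.update_add,
    lintegral_add_right_eq_self fun xᵢ => indicator (univ.pi s) 1 (Function.update x t_i xᵢ)]

theorem map_diagonal_pi (hF : NormIsModulus F) (D : ι → F) (hD : (Matrix.diagonal D).det ≠ 0) :
    map (Matrix.toLin' (Matrix.diagonal D)) (Measure.pi fun _ : ι => (addHaar : Measure F)) =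
      ‖(Matrix.diagonal D).det‖ₑ⁻¹ • Measure.pi fun _ => addHaar := by
  rw [Matrix.det_diagonal] at hD ⊢
  have hD' : ∀ i, D i ≠ 0 := fun i => Finset.prod_ne_zero_iff.1 hD i (Finset.mem_univ i)
  have hn : ∀ i, ‖D i‖ₑ ≠ 0 := fun i => enorm_ne_zero.2 (hD' i)
  have hp : ‖∏ i, D i‖ₑ = ∏ i, ‖D i‖ₑ := by
    simp only [← ofReal_norm, norm_prod]
    exact ENNReal.ofReal_prod_of_nonneg fun i _ => norm_nonneg _
  have hpi : (Measure.pi fun _ : ι => (addHaar : Measure F)) = ‖∏ i, D i‖ₑ •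
      map (Matrix.toLin' (Matrix.diagonal D)) (Measure.pi fun _ : ι => (addHaar : Measure F)) := by
    refine pi_eq fun s hs => ?_
    have hpre : Matrix.toLin' (Matrix.diagonal D) ⁻¹' univ.pi s =
        univ.pi fun i => (fun x => D i * x) ⁻¹' s i := by
      ext x; simp [Matrix.mulVec_diagonal]
    rw [Measure.smul_apply, map_apply (continuous_toLin'_matrix _).measurable
      (.pi countable_univ fun i _ => hs i), hpre, pi_pi, hp, smul_eq_mul, ← Finset.prod_mul_distrib]
    refine Finset.prod_congr rfl fun i _ => ?_
    rw [← map_apply (measurable_const_mul (D i)) (hs i), hF _ (hD' i), Measure.smul_apply,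
      smul_eq_mul, ← mul_assoc, ENNReal.mul_inv_cancel (hn i) enorm_ne_top, one_mul]
  conv_rhs => rw [hpi]
  rw [smul_smul, ENNReal.inv_mul_cancel (enorm_ne_zero.2 hD) enorm_ne_top, one_smul]

/-- An invertible matrix is a product of transvections and a diagonal matrix. The former preserve
the product measure, the latter scales it coordinate by coordinate, and both sides are
multiplicative in M. -/
theorem map_matrix_pi (hF : NormIsModulus F) (M : Matrix ι ι F) (hM : M.det ≠ 0) :
    map (Matrix.toLin' M) (Measure.pi fun _ : ι => (addHaar : Measure F)) =
      ‖M.det‖ₑ⁻¹ • Measure.pi fun _ => addHaar := by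
  refine Matrix.diagonal_transvection_induction_of_det_ne_zero (fun M =>
    map (Matrix.toLin' M) (Measure.pi fun _ : ι => (addHaar : Measure F)) =
      ‖M.det‖ₑ⁻¹ • Measure.pi fun _ => addHaar) M hM (map_diagonal_pi hF) ?_ ?_
  · intro t
    rw [map_transvection_pi, t.det]
    simp
  · intro A B hA hB IHA IHB
    rw [Matrix.toLin'_mul, Matrix.det_mul, LinearMap.coe_comp,
      ← map_map (continuous_toLin'_matrix A).measurable (continuous_toLin'_matrix B).measurable,
      IHB, Measure.map_smul, IHA, smul_smul, enorm_mul,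
      ENNReal.mul_inv (.inl (enorm_ne_zero.2 hA)) (.inl enorm_ne_top), mul_comm]

variable {V : Type*} [AddCommGroup V] [Module F V] [FiniteDimensional F V] [TopologicalSpace V]
  [IsModuleTopology F V] [IsTopologicalAddGroup V] [LocallyCompactSpace V]
  [MeasurableSpace V] [BorelSpace V]

/-- A linear automorphism scales the Haar measure by the absolute value of its determinant. -/
theorem map_linearEquiv_addHaar (hF : NormIsModulus F) (φ : V ≃ₗ[F] V) :
    map φ (addHaar : Measure V) = ‖LinearMap.det (φ : V →ₗ[F] V)‖ₑ⁻¹ • addHaar := by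
  let b := Module.finBasis F V
  let e := b.equivFun
  have hc : ∀ f : V →ₗ[F] V, Continuous f := IsModuleTopology.continuous_of_linearMap
  have he : Continuous e := IsModuleTopology.continuous_of_linearMap e.toLinearMap
  have he' : Continuous e.symm := IsModuleTopology.continuous_of_linearMap e.symm.toLinearMap
  let H : V ≃ₜ (Fin (Module.finrank F V) → F) := ⟨e.toEquiv, he, he'⟩
  have : SecondCountableTopology V := H.secondCountableTopology
  let P : Measure (Fin (Module.finrank F V) → F) := Measure.pi fun _ => addHaar
  have : IsAddHaarMeasure (map e.symm P) :=
    e.symm.toAddEquiv.isAddHaarMeasure_map P he' he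
  -- By uniqueness, Haar measure on V is a multiple of the product measure transported through a
  -- basis. The multiple is unknown but occurs on both sides, so the matrix case suffices.
  have hμ := isAddLeftInvariant_eq_smul (addHaar : Measure V) (map e.symm P)
  have hφ : Measurable φ := (hc φ.toLinearMap).measurable
  have hdet : LinearMap.det (φ : V →ₗ[F] V) = (LinearMap.toMatrix b b (φ : V →ₗ[F] V)).det :=
    (LinearMap.det_toMatrix b _).symm
  have hcomp : ⇑φ ∘ ⇑e.symm =
      ⇑e.symm ∘ ⇑(Matrix.toLin' (LinearMap.toMatrix b b (φ : V →ₗ[F] V))) := by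
    funext x
    obtain ⟨y, rfl⟩ := e.surjective x
    apply e.injective
    simp only [Function.comp_apply, LinearEquiv.symm_apply_apply, LinearEquiv.apply_symm_apply,
      Matrix.toLin'_apply]
    exact (LinearMap.toMatrix_mulVec_repr b b (φ : V →ₗ[F] V) y).symm
  rw [hμ, Measure.map_smul, map_map hφ he'.measurable, hcomp,
    ← map_map he'.measurable (continuous_toLin'_matrix _).measurable, map_matrix_pi hF,
    Measure.map_smul, hdet, smul_comm]
  rw [← hdet]
  exact (LinearEquiv.isUnit_det' φ).ne_zero

end Modulus

/-! ### The absolute values of the completions are moduli -/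

section LocalFields
open Measure Set
open scoped ENNReal

/-- Haar measures are proportional, so the scaling law may be checked on any one of them. -/
theorem normIsModulus_of_isAddHaarMeasure {F : Type*} [NormedField F] [LocallyCompactSpace F]
    [SecondCountableTopology F] [MeasurableSpace F] [BorelSpace F] (μ : Measure F)
    [IsAddHaarMeasure μ]
    (h : ∀ a : F, a ≠ 0 → map (fun x => a * x) μ = ‖a‖ₑ⁻¹ • μ) : NormIsModulus F := by
  intro a ha
  rw [isAddLeftInvariant_eq_smul (addHaar : Measure F) μ, Measure.map_smul, h a ha, smul_comm]

variable {E : Type*} [Field E]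

instance (v : InfinitePlace E) : SecondCountableTopology v.Completion :=
  (InfinitePlace.Completion.isometry_extensionEmbedding v).isEmbedding.secondCountableTopology

/-- Lebesgue measure is transported along the isometry of the completion with ℝ. Total reality is
essential: at a complex place the modulus would be the square of the absolute value. -/
theorem normIsModulus_completion [IsTotallyReal E] (v : InfinitePlace E)
    [MeasurableSpace v.Completion] [BorelSpace v.Completion] : NormIsModulus v.Completion := by
  have hv : v.IsReal := IsTotallyReal.isReal v
  let e := InfinitePlace.Completion.ringEquivRealOfIsReal hv
  let H : v.Completion ≃ᵢ ℝ := InfinitePlace.Completion.isometryEquivRealOfIsReal hv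
  have he : Continuous e := H.continuous
  have he' : Continuous e.symm := H.symm.continuous
  have : IsAddHaarMeasure (map e.symm (volume : Measure ℝ)) :=
    e.symm.toAddEquiv.isAddHaarMeasure_map volume he' he
  refine normIsModulus_of_isAddHaarMeasure (map e.symm (volume : Measure ℝ)) fun a ha => ?_
  have hcomp : (fun x => a * x) ∘ e.symm = e.symm ∘ fun x => e a * x := by
    funext x; simp
  have hea : e a ≠ 0 := (map_ne_zero e).2 ha
  have hn : ‖e a‖ = ‖a‖ := by
    have := H.dist_eq a 0
    rw [dist_zero_right] at this
    rw [← this, ← dist_zero_right, ← map_zero e]; rfl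
  rw [map_map (measurable_const_mul a) he'.measurable, hcomp,
    ← map_map he'.measurable (measurable_const_mul _), Real.map_volume_mul_left hea,
    Measure.map_smul, abs_inv, ENNReal.ofReal_inv_of_pos (abs_pos.2 hea), ← Real.norm_eq_abs, hn,
    ofReal_norm]


variable [NumberField E]

instance (v : HeightOneSpectrum (𝓞 E)) : SecondCountableTopology (v.adicCompletion E) := by
  have : Countable E := (Module.finBasis ℚ E).equivFun.injective.countable
  have : TopologicalSpace.SeparableSpace (v.adicCompletion E) :=
    ⟨range (algebraMap E (v.adicCompletion E)), countable_range _,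
      HeightOneSpectrum.denseRange_algebraMap E v⟩
  exact UniformSpace.secondCountable_of_separable _

theorem mem_adicCompletionIntegers_iff_norm_le_one {v : HeightOneSpectrum (𝓞 E)}
    {x : v.adicCompletion E} : x ∈ v.adicCompletionIntegers E ↔ ‖x‖ ≤ 1 := by
  rw [Valued.toNormedField.norm_le_one_iff]; rfl

/-- This says that `𝓞 E` surjects onto the residue field of the completion. By density x is close to
some k in E, which is then v-integral and hence congruent to an algebraic integer. -/
theorem exists_integer_norm_sub_lt_one {v : HeightOneSpectrum (𝓞 E)} {x : v.adicCompletion E}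
    (hx : ‖x‖ ≤ 1) : ∃ a : 𝓞 E, ‖x - algebraMap E (v.adicCompletion E) a‖ < 1 := by
  obtain ⟨k, hk⟩ := (HeightOneSpectrum.denseRange_algebraMap (K := E) v).exists_dist_lt x
    one_pos
  rw [dist_eq_norm] at hk
  have hk1 : ‖algebraMap E (v.adicCompletion E) k‖ ≤ 1 := by
    rw [← sub_sub_cancel x (algebraMap E (v.adicCompletion E) k), sub_eq_add_neg]
    refine (IsUltrametricDist.norm_add_le_max _ _).trans (max_le hx ?_)
    rw [norm_neg]; exact hk.le
  have hk2 : v.valuation E k ≤ 1 := by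
    rw [← HeightOneSpectrum.valuedAdicCompletion_eq_valuation']
    exact Valued.toNormedField.norm_le_one_iff.1 hk1
  obtain ⟨a, ha⟩ := v.exists_valuation_sub_lt_of_integer hk2 1
  refine ⟨a, ?_⟩
  have h1 : ‖algebraMap E (v.adicCompletion E) (k - a)‖ < 1 := by
    rw [Valued.toNormedField.norm_lt_one_iff]
    have := HeightOneSpectrum.valuedAdicCompletion_eq_valuation' (v := v) (k - algebraMap (𝓞 E) E a)
    refine this.trans_lt ?_
    rw [Valuation.map_sub_swap]
    simpa using ha
  rw [map_sub] at h1
  rw [← sub_add_sub_cancel x (algebraMap E (v.adicCompletion E) k)]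
  exact (IsUltrametricDist.norm_add_le_max _ _).trans_lt (max_lt hk h1)

theorem norm_algebraMap_lt_one_iff {v : HeightOneSpectrum (𝓞 E)} (a : 𝓞 E) :
    ‖algebraMap E (v.adicCompletion E) a‖ < 1 ↔ a ∈ v.asIdeal :=
  FinitePlace.norm_lt_one_iff_mem E v a

theorem exists_norm_eq_absNorm_inv (v : HeightOneSpectrum (𝓞 E)) :
    ∃ π : v.adicCompletion E, ‖π‖ = (Ideal.absNorm v.asIdeal : ℝ)⁻¹ ∧
      ∀ x : v.adicCompletion E, x ≠ 0 → ∃ k : ℤ, ‖x‖ = ‖π ^ k‖ := by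
  obtain ⟨π, hπ⟩ := v.valuation_exists_uniformizer E
  have hnorm : ‖algebraMap E (v.adicCompletion E) π‖ = (Ideal.absNorm v.asIdeal : ℝ)⁻¹ := by
    have := FinitePlace.norm_embedding' (v := v) π
    refine this.trans ?_
    rw [hπ, WithZeroMulInt.toNNReal_neg_apply _ WithZero.exp_ne_zero]
    push_cast
    exact zpow_neg_one _
  refine ⟨algebraMap E _ π, hnorm, fun x hx => ?_⟩
  simp only [norm_zpow, hnorm]
  rw [FinitePlace.norm_def, WithZeroMulInt.toNNReal_neg_apply _
    ((Valuation.ne_zero_iff _).2 hx)]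
  exact ⟨-Multiplicative.toAdd (WithZero.unzero ((Valuation.ne_zero_iff _).2 hx)), by
    rw [inv_zpow', neg_neg]; push_cast; rfl⟩

theorem norm_lt_norm_iff_of_uniformizer {v : HeightOneSpectrum (𝓞 E)} {π : v.adicCompletion E}
    (h1 : ‖π‖ = (Ideal.absNorm v.asIdeal : ℝ)⁻¹)
    (h2 : ∀ x : v.adicCompletion E, x ≠ 0 → ∃ k : ℤ, ‖x‖ = ‖π ^ k‖)
    {x : v.adicCompletion E} : ‖x‖ < 1 ↔ ‖x‖ ≤ ‖π‖ := by
  have hN : 1 < (Ideal.absNorm v.asIdeal : ℝ) :=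
    mod_cast NumberField.HeightOneSpectrum.one_lt_absNorm v
  have hπ1 : ‖π‖ < 1 := h1 ▸ inv_lt_one_of_one_lt₀ hN
  have hπ0 : 0 < ‖π‖ := h1 ▸ inv_pos.2 (one_pos.trans hN)
  refine ⟨fun hx => ?_, fun hx => hx.trans_lt hπ1⟩
  by_cases h0 : x = 0
  · rw [h0, norm_zero]; exact norm_nonneg _
  · obtain ⟨k, hk⟩ := h2 x h0
    rw [hk, norm_zpow] at hx ⊢
    have hk0 : 0 < k := by
      by_contra! h
      exact hx.not_ge (one_le_zpow_of_nonpos₀ hπ0 hπ1.le h)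
    calc ‖π‖ ^ k ≤ ‖π‖ ^ (1 : ℤ) := zpow_le_zpow_right_of_le_one₀ hπ0 hπ1.le hk0
      _ = ‖π‖ := zpow_one _

/-- The larger ball is the disjoint union of the translates of the smaller one by a·r, with r
running over representatives of the residue classes modulo v; there are `Ideal.absNorm v.asIdeal` of
them, all of the same measure. -/
theorem measure_closedBall_eq_absNorm_mul {v : HeightOneSpectrum (𝓞 E)}
    [MeasurableSpace (v.adicCompletion E)] [BorelSpace (v.adicCompletion E)]
    (μ : Measure (v.adicCompletion E)) [μ.IsAddLeftInvariant]
    {π : v.adicCompletion E} (h1 : ‖π‖ = (Ideal.absNorm v.asIdeal : ℝ)⁻¹)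
    (h2 : ∀ x : v.adicCompletion E, x ≠ 0 → ∃ k : ℤ, ‖x‖ = ‖π ^ k‖)
    {a : v.adicCompletion E} (ha : a ≠ 0) :
    μ (Metric.closedBall 0 ‖a‖) =
      Ideal.absNorm v.asIdeal * μ (Metric.closedBall 0 ‖a * π‖) := by
  have hfin : Finite (𝓞 E ⧸ v.asIdeal) := v.asIdeal.finiteQuotientOfFreeOfNeBot v.ne_bot
  let c : 𝓞 E ⧸ v.asIdeal → v.adicCompletion E := fun r =>
    a * algebraMap E (v.adicCompletion E) (Quotient.out r : 𝓞 E)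
  have hna : 0 < ‖a‖ := norm_pos_iff.2 ha
  have hle : ∀ y : v.adicCompletion E, ‖y‖ ≤ ‖a * π‖ ↔ ‖a⁻¹ * y‖ < 1 := fun y => by
    rw [norm_lt_norm_iff_of_uniformizer h1 h2, norm_mul, norm_mul, norm_inv, inv_mul_le_iff₀ hna]
  have hball : Metric.closedBall (0 : v.adicCompletion E) ‖a‖ =
      ⋃ r, (fun x => -c r + x) ⁻¹' Metric.closedBall 0 ‖a * π‖ := by
    ext x
    simp only [mem_iUnion, mem_preimage, mem_closedBall_zero_iff, hle]
    have hc : ∀ r, a⁻¹ * (-c r + x) =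
        a⁻¹ * x - algebraMap E (v.adicCompletion E) (Quotient.out r : 𝓞 E) := fun r => by
      simp only [c]; field_simp; ring
    simp only [hc]
    constructor
    · intro hx
      obtain ⟨b, hb⟩ := exists_integer_norm_sub_lt_one (v := v) (x := a⁻¹ * x) (by
        rw [norm_mul, norm_inv, inv_mul_le_iff₀ hna, mul_one]; exact hx)
      refine ⟨Ideal.Quotient.mk _ b, ?_⟩
      have hmem : b - Quotient.out (Ideal.Quotient.mk v.asIdeal b) ∈ v.asIdeal := by
        rw [← Ideal.Quotient.eq]; exact (Quotient.out_eq _).symm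
      have hlt := (norm_algebraMap_lt_one_iff (v := v) _).2 hmem
      rw [show ((b - Quotient.out (Ideal.Quotient.mk v.asIdeal b) : 𝓞 E) : E) =
        (b : E) - (Quotient.out (Ideal.Quotient.mk v.asIdeal b) : 𝓞 E) from
        map_sub (algebraMap (𝓞 E) E) _ _, map_sub] at hlt
      rw [← sub_add_sub_cancel _ (algebraMap E (v.adicCompletion E) b)]
      exact (IsUltrametricDist.norm_add_le_max _ _).trans_lt (max_lt hb hlt)
    · rintro ⟨r, hr⟩
      have hr1 : ‖algebraMap E (v.adicCompletion E) (Quotient.out r : 𝓞 E)‖ ≤ 1 :=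
        FinitePlace.norm_le_one E v _
      have := (IsUltrametricDist.norm_add_le_max _ _).trans (max_le hr.le hr1)
      rwa [sub_add_cancel, norm_mul, norm_inv, inv_mul_le_iff₀ hna, mul_one] at this
  have hmeas : ∀ r, MeasurableSet ((fun x => -c r + x) ⁻¹' Metric.closedBall 0 ‖a * π‖) := fun r =>
    measurable_const_add _ Metric.isClosed_closedBall.measurableSet
  have hdisj : Pairwise (Function.onFun Disjoint fun r =>
      (fun x => -c r + x) ⁻¹' Metric.closedBall 0 ‖a * π‖) := by
    intro r r' hrr'
    refine Set.disjoint_left.2 fun x hx hx' => hrr' ?_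
    simp only [mem_preimage, mem_closedBall_zero_iff, hle] at hx hx'
    have h3 : ‖algebraMap E (v.adicCompletion E)
        ((Quotient.out r - Quotient.out r' : 𝓞 E) : E)‖ < 1 := by
      have h4 := (IsUltrametricDist.norm_add_le_max (a⁻¹ * (-c r' + x))
        (-(a⁻¹ * (-c r + x)))).trans_lt (max_lt hx' (by rwa [norm_neg]))
      have heq : algebraMap E (v.adicCompletion E) ((Quotient.out r - Quotient.out r' : 𝓞 E) : E) =
          a⁻¹ * (-c r' + x) + -(a⁻¹ * (-c r + x)) := by
        rw [show ((Quotient.out r - Quotient.out r' : 𝓞 E) : E) =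
          (Quotient.out r : 𝓞 E) - (Quotient.out r' : 𝓞 E) from
          map_sub (algebraMap (𝓞 E) E) _ _, map_sub]
        simp only [c]
        field_simp; ring
      rwa [heq]
    have h5 := (norm_algebraMap_lt_one_iff _).1 h3
    rw [← Ideal.Quotient.eq] at h5
    simpa using h5
  have := Fintype.ofFinite (𝓞 E ⧸ v.asIdeal)
  conv_lhs => rw [hball, measure_iUnion hdisj hmeas]
  have hinv : ∀ r, μ ((fun x => -c r + x) ⁻¹' Metric.closedBall 0 ‖a * π‖) =
      μ (Metric.closedBall 0 ‖a * π‖) := fun r => measure_preimage_add μ _ _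
  simp only [hinv]
  rw [tsum_fintype, Finset.sum_const, nsmul_eq_mul, Finset.card_univ, ← Nat.card_eq_fintype_card]
  rfl

/-- Multiplication by a nonzero a sends Haar measure to a multiple of itself, and the multiple can
be read off from the unit ball, whose preimage is the ball of radius ‖a⁻¹‖. Every nonzero norm is a
power of ‖π‖, so residue class counts give the measures of all such balls. -/
theorem normIsModulus_adicCompletion (v : HeightOneSpectrum (𝓞 E))
    [MeasurableSpace (v.adicCompletion E)] [BorelSpace (v.adicCompletion E)] :
    NormIsModulus (v.adicCompletion E) := by
  obtain ⟨π, h1, h2⟩ := exists_norm_eq_absNorm_inv v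
  have hN : 1 < (Ideal.absNorm v.asIdeal : ℝ) :=
    mod_cast NumberField.HeightOneSpectrum.one_lt_absNorm v
  have hπ : π ≠ 0 := norm_ne_zero_iff.1 (h1 ▸ (inv_pos.2 (one_pos.trans hN)).ne')
  have hπe : (Ideal.absNorm v.asIdeal : ℝ≥0∞) * ‖π‖ₑ = 1 := by
    rw [← ofReal_norm, h1, ENNReal.ofReal_inv_of_pos (one_pos.trans hN), ENNReal.ofReal_natCast,
      ENNReal.mul_inv_cancel]
    · exact_mod_cast (one_pos.trans hN).ne'
    · exact ENNReal.natCast_ne_top _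
  let μ : Measure (v.adicCompletion E) := addHaar
  have hstep := fun a ha => measure_closedBall_eq_absNorm_mul μ h1 h2 (a := a) ha
  -- Induction in both directions from k = 0; each step changes the radius by ‖π‖ and the measure by
  -- the same factor, since N(v)·‖π‖ = 1.
  have hpow : ∀ k : ℤ, μ (Metric.closedBall 0 ‖π ^ k‖) = ‖π ^ k‖ₑ * μ (Metric.closedBall 0 1) := by
    intro k
    induction k with
    | zero => simp
    | succ k ih =>
      rw [hstep _ (zpow_ne_zero _ hπ), ← zpow_add_one₀ hπ] at ih
      rw [zpow_add_one₀ hπ, enorm_mul, mul_right_comm, ← ih, zpow_add_one₀ hπ, mul_right_comm, hπe,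
        one_mul]
    | pred k ih =>
      rw [hstep _ (zpow_ne_zero _ hπ), ← zpow_add_one₀ hπ, sub_add_cancel, ih, ← mul_assoc]
      congr 1
      conv_lhs => rw [← sub_add_cancel (-(k : ℤ)) 1, zpow_add_one₀ hπ, enorm_mul, mul_comm,
        mul_assoc, mul_comm ‖π‖ₑ, hπe, mul_one]
  have hball : ∀ a : v.adicCompletion E, a ≠ 0 →
      μ (Metric.closedBall 0 ‖a‖) = ‖a‖ₑ * μ (Metric.closedBall 0 1) := by
    intro a ha
    obtain ⟨k, hk⟩ := h2 a ha
    rw [hk, hpow, ← ofReal_norm, ← ofReal_norm, hk]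
  intro a ha
  have : IsAddHaarMeasure (map (LinearEquiv.smulOfNeZero _ (v.adicCompletion E) a ha) μ) :=
    (LinearEquiv.smulOfNeZero _ (v.adicCompletion E) a ha).toAddEquiv.isAddHaarMeasure_map μ
      (continuous_const_mul a) (continuous_const_mul a⁻¹)
  have hφ : map (fun x => a * x) μ = _ • μ :=
    isAddLeftInvariant_eq_smul (map (LinearEquiv.smulOfNeZero _ (v.adicCompletion E) a ha) μ) μ
  have hO : μ (Metric.closedBall 0 1) ≠ 0 :=
    (Metric.measure_closedBall_pos μ 0 one_pos).ne'
  -- Some small closed ball is compact, hence of finite measure, and `hpow` compares the unit ball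
  -- with a ball inside it.
  have hO' : μ (Metric.closedBall 0 1) ≠ ∞ := by
    obtain ⟨r, hr, hcomp⟩ := Metric.exists_isCompact_closedBall (0 : v.adicCompletion E)
    have hπ1 : ‖π‖ < 1 := h1 ▸ inv_lt_one_of_one_lt₀ hN
    obtain ⟨k, hk⟩ := exists_pow_lt_of_lt_one hr hπ1
    have hsub : Metric.closedBall (0 : v.adicCompletion E) ‖π ^ (k : ℤ)‖ ⊆ Metric.closedBall 0 r :=
      Metric.closedBall_subset_closedBall (by rw [zpow_natCast, norm_pow]; exact hk.le)
    have hlt := (measure_mono hsub).trans_lt (hcomp.measure_lt_top (μ := μ))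
    rw [hpow] at hlt
    exact (ENNReal.lt_top_of_mul_ne_top_right hlt.ne (by simp [hπ])).ne
  have hval : map (fun x => a * x) μ (Metric.closedBall 0 1) =
      ‖a‖ₑ⁻¹ * μ (Metric.closedBall 0 1) := by
    rw [map_apply (measurable_const_mul a) Metric.isClosed_closedBall.measurableSet]
    have : (fun x => a * x) ⁻¹' Metric.closedBall 0 1 = Metric.closedBall 0 ‖a⁻¹‖ := by
      ext x
      simp only [mem_preimage, mem_closedBall_zero_iff, norm_mul, norm_inv]
      rw [← one_div, le_div_iff₀' (norm_pos_iff.2 ha)]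
    rw [this, hball _ (inv_ne_zero ha), enorm_inv ha]
  change map (fun x => a * x) μ = ‖a‖ₑ⁻¹ • μ
  rw [hφ, Measure.smul_apply] at hval
  rw [hφ]
  refine Measure.ext fun s hs => ?_
  rw [Measure.smul_apply, Measure.smul_apply]
  change (_ : ℝ≥0∞) * _ = _ at hval
  change (_ : ℝ≥0∞) * _ = _
  rw [(ENNReal.mul_left_inj hO hO').1 hval]
  rfl
end LocalFields

/-! ### Units of `A_K` supported at one place -/

section ExtendByOne

variable {E K : Type*} [Field E] [Field K] [Algebra E K]
variable {R S S' : Type*} [CommRing R] [CommRing S] [CommRing S'] [Algebra E R] [Algebra E S]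
  [Algebra E S']

variable (K) in
/-- The homomorphism `(R ⊗ K)ˣ → (S ⊗ K)ˣ` induced by a morphism `R → S`. -/
def unitsBaseMap (π : R →ₐ[E] S) : (R ⊗[E] K)ˣ →* (S ⊗[E] K)ˣ :=
  Units.map (baseMap π K : (R ⊗[E] K) →* (S ⊗[E] K))

theorem unitsBaseMap_val (π : R →ₐ[E] S) (x : (R ⊗[E] K)ˣ) :
    (unitsBaseMap K π x : S ⊗[E] K) = baseMap π K x := rfl

theorem extendByOne_val (ι : R →ₗ[E] S) (hι : ∀ x y, ι (x * y) = ι x * ι y) (u : (R ⊗[E] K)ˣ) :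
    (extendByOne K ι hι u : S ⊗[E] K) =
      ι.rTensor K (u : R ⊗[E] K) + (1 - ι.rTensor K (1 : R ⊗[E] K)) := rfl

theorem baseMap_rTensor (ι : R →ₗ[E] S) (π : S →ₐ[E] S') (z : R ⊗[E] K) :
    baseMap π K (ι.rTensor K z) = (π.toLinearMap ∘ₗ ι).rTensor K z := by
  induction z with
  | zero => simp
  | tmul r k => simp [baseMap]
  | add x y hx hy => simp only [map_add, hx, hy]

theorem unitsBaseMap_extendByOne_self (ι : R →ₗ[E] S) (hι : ∀ x y, ι (x * y) = ι x * ι y)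
    (π : S →ₐ[E] R) (h : ∀ x, π (ι x) = x) (u : (R ⊗[E] K)ˣ) :
    unitsBaseMap K π (extendByOne K ι hι u) = u := by
  apply Units.ext
  have : π.toLinearMap ∘ₗ ι = LinearMap.id := LinearMap.ext h
  rw [unitsBaseMap_val, extendByOne_val, map_add, map_sub, map_one, baseMap_rTensor,
    baseMap_rTensor, this]
  simp

theorem unitsBaseMap_extendByOne_of_eq_zero (ι : R →ₗ[E] S) (hι : ∀ x y, ι (x * y) = ι x * ι y)
    (π : S →ₐ[E] S') (h : ∀ x, π (ι x) = 0) (u : (R ⊗[E] K)ˣ) :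
    unitsBaseMap K π (extendByOne K ι hι u) = 1 := by
  apply Units.ext
  have : π.toLinearMap ∘ₗ ι = 0 := LinearMap.ext h
  rw [unitsBaseMap_val, extendByOne_val, map_add, map_sub, map_one, baseMap_rTensor,
    baseMap_rTensor, this]
  simp

theorem baseMap_algebraMap_add_smul_tmul (π : R →ₐ[E] S) (a b : R) (δ : K) :
    baseMap π K (algebraMap R (R ⊗[E] K) a + b • (1 : R) ⊗ₜ[E] δ) =
      algebraMap S (S ⊗[E] K) (π a) + π b • (1 : S) ⊗ₜ[E] δ := by
  simp [baseMap, Algebra.TensorProduct.algebraMap_apply, TensorProduct.smul_tmul']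

theorem algebraMap_one_add_zero_smul (z : R ⊗[E] K) :
    algebraMap R (R ⊗[E] K) 1 + (0 : R) • z = 1 := by
  rw [map_one, zero_smul, add_zero]

end ExtendByOne

/-! ### Local components, integrality and neighbourhoods of 1 in `A_K` -/

section Components

variable {E : Type*} [Field E] [NumberField E]

theorem compInf_inclInf_self (v : InfinitePlace E) (x : v.Completion) :
    compInf v (inclInf v x) = x := by
  classical
  exact Pi.single_eq_same (M := fun w : InfinitePlace E => w.Completion) v x

theorem compInf_inclInf_of_ne {v w : InfinitePlace E} (h : w ≠ v) (x : v.Completion) :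
    compInf w (inclInf v x) = 0 := by
  classical
  exact Pi.single_eq_of_ne (M := fun w : InfinitePlace E => w.Completion) h x

theorem compFin_inclFin_self (v : HeightOneSpectrum (𝓞 E)) (x : v.adicCompletion E) :
    compFin v (inclFin v x) = x := by
  classical
  exact Pi.single_eq_same (M := fun w : HeightOneSpectrum (𝓞 E) => w.adicCompletion E) v x

theorem compFin_inclFin_of_ne {v w : HeightOneSpectrum (𝓞 E)} (h : w ≠ v)
    (x : v.adicCompletion E) : compFin w (inclFin v x) = 0 := by
  classical
  exact Pi.single_eq_of_ne (M := fun w : HeightOneSpectrum (𝓞 E) => w.adicCompletion E) h x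

theorem compFin_inclInf (v : InfinitePlace E) (w : HeightOneSpectrum (𝓞 E)) (x : v.Completion) :
    compFin w (inclInf v x) = 0 := rfl

theorem compInf_inclFin (v : HeightOneSpectrum (𝓞 E)) (w : InfinitePlace E)
    (x : v.adicCompletion E) : compInf w (inclFin v x) = 0 := rfl

theorem adele_ext {x y : AE E} (h1 : ∀ v, compInf v x = compInf v y)
    (h2 : ∀ v, compFin v x = compFin v y) : x = y :=
  Prod.ext (funext h1) (FiniteAdeleRing.ext E h2)

theorem eventually_compFin_mem (x : AE E) :
    ∀ᶠ v in Filter.cofinite, compFin v x ∈ v.adicCompletionIntegers E := x.2.2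

theorem eventually_algebraMap_mem (x : E) :
    ∀ᶠ v in Filter.cofinite, algebraMap E (HeightOneSpectrum.adicCompletion E v) x ∈
      HeightOneSpectrum.adicCompletionIntegers (R := 𝓞 E) E v :=
  eventually_compFin_mem (algebraMap E (AE E) x)

/-- At almost all places both the idele and its inverse are integral, and their norms multiply to 1.
-/
theorem eventually_norm_compFin_eq_one {x : AE E} (hx : IsUnit x) :
    ∀ᶠ v in Filter.cofinite, ‖compFin v x‖ = 1 := by
  obtain ⟨u, rfl⟩ := hx
  filter_upwards [eventually_compFin_mem (u : AE E),
    eventually_compFin_mem ((u⁻¹ : (AE E)ˣ) : AE E)] with v h1 h2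
  rw [mem_adicCompletionIntegers_iff_norm_le_one] at h1 h2
  have h3 : ‖compFin v (u : AE E)‖ * ‖compFin v ((u⁻¹ : (AE E)ˣ) : AE E)‖ = 1 := by
    rw [← norm_mul, ← map_mul, Units.mul_inv, map_one, norm_one]
  exact le_antisymm h1 (h3 ▸ mul_le_of_le_one_right (norm_nonneg _) h2)

variable {K : Type*} [Field K] [Algebra E K]

/-- The set `O_v + O_v δ` in `E_v ⊗ K`. -/
def localOrder (δ : K) (v : HeightOneSpectrum (𝓞 E)) : Set (v.adicCompletion E ⊗[E] K) :=
  {z | ∃ a ∈ v.adicCompletionIntegers E, ∃ b ∈ v.adicCompletionIntegers E,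
    z = algebraMap (v.adicCompletion E) _ a + b • (1 : v.adicCompletion E) ⊗ₜ[E] δ}

theorem one_mem_localOrder (δ : K) (v : HeightOneSpectrum (𝓞 E)) : 1 ∈ localOrder δ v :=
  ⟨1, one_mem _, 0, zero_mem _, (algebraMap_one_add_zero_smul _).symm⟩

/-- Since δ² = d lies in E, the lattice O_v + O_v δ is closed under multiplication as soon as d is
integral at v. -/
theorem mul_mem_localOrder {δ : K} {v : HeightOneSpectrum (𝓞 E)} {d : E}
    (hd : algebraMap E K d = δ * δ)
    (hdv : algebraMap E (v.adicCompletion E) d ∈ v.adicCompletionIntegers E)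
    {x y : v.adicCompletion E ⊗[E] K} (hx : x ∈ localOrder δ v) (hy : y ∈ localOrder δ v) :
    x * y ∈ localOrder δ v := by
  obtain ⟨a, ha, b, hb, rfl⟩ := hx
  obtain ⟨a', ha', b', hb', rfl⟩ := hy
  refine ⟨a * a' + b * b' * algebraMap E _ d,
    add_mem (mul_mem ha ha') (mul_mem (mul_mem hb hb') hdv), a * b' + a' * b,
    add_mem (mul_mem ha hb') (mul_mem ha' hb), ?_⟩
  have h1 : ((1 : v.adicCompletion E) ⊗ₜ[E] δ) * ((1 : v.adicCompletion E) ⊗ₜ[E] δ) =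
      algebraMap (v.adicCompletion E) _ (algebraMap E (v.adicCompletion E) d) := by
    rw [Algebra.TensorProduct.tmul_mul_tmul, ← hd, mul_one,
      ← IsScalarTower.algebraMap_apply]
    exact (Algebra.TensorProduct.algebraMap_apply' d).symm
  simp only [Algebra.smul_def, map_add, map_mul]
  linear_combination (algebraMap (v.adicCompletion E) (v.adicCompletion E ⊗[E] K) b) *
    (algebraMap (v.adicCompletion E) (v.adicCompletion E ⊗[E] K) b') * h1

theorem pow_mem_localOrder {δ : K} {v : HeightOneSpectrum (𝓞 E)} {d : E}
    (hd : algebraMap E K d = δ * δ)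
    (hdv : algebraMap E (v.adicCompletion E) d ∈ v.adicCompletionIntegers E)
    {x : v.adicCompletion E ⊗[E] K} (hx : x ∈ localOrder δ v) (k : ℕ) :
    x ^ k ∈ localOrder δ v := by
  induction k with
  | zero => rw [pow_zero]; exact one_mem_localOrder δ v
  | succ k ih => rw [pow_succ]; exact mul_mem_localOrder hd hdv ih hx

open Topology

/-- A neighbourhood of `1` in `A_K` contains all elements that are `1` at the infinite and at
finitely many finite places and integral at the others. -/
theorem exists_finset_forall_mem_of_mem_nhds_one [TopologicalSpace (AE E ⊗[E] K)]
    [IsModuleTopology (AE E) (AE E ⊗[E] K)] {U : Set (AE E ⊗[E] K)} (hU : U ∈ 𝓝 1) (δ : K) :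
    ∃ T : Finset (HeightOneSpectrum (𝓞 E)), ∀ a b : AE E,
      (∀ v, compInf v a = 1 ∧ compInf v b = 0) →
      (∀ v ∈ T, compFin v a = 1 ∧ compFin v b = 0) →
      (∀ v, compFin v a ∈ v.adicCompletionIntegers E ∧
        compFin v b ∈ v.adicCompletionIntegers E) →
      algebraMap (AE E) (AE E ⊗[E] K) a + b • (1 : AE E) ⊗ₜ[E] δ ∈ U := by
  have := IsModuleTopology.toContinuousAdd (AE E) (AE E ⊗[E] K)
  have := IsModuleTopology.toContinuousSMul (AE E) (AE E ⊗[E] K)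
  let Φ : AE E × AE E →ₗ[AE E] AE E ⊗[E] K :=
    LinearMap.coprod (Algebra.linearMap (AE E) (AE E ⊗[E] K))
      (LinearMap.toSpanSingleton (AE E) _ ((1 : AE E) ⊗ₜ[E] δ))
  have hΦ : Continuous Φ := IsModuleTopology.continuous_of_linearMap Φ
  let P := (v : HeightOneSpectrum (𝓞 E)) → v.adicCompletionIntegers E
  let σ : P → FiniteAdeleRing (𝓞 E) E := RestrictedProduct.structureMap _ _ _
  have hσ : Continuous σ := RestrictedProduct.isEmbedding_structureMap.continuous
  -- Fixing the infinite components at 1 and 0 leaves a continuous map from products of local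
  -- integer rings, where a basic neighbourhood constrains only finitely many coordinates. These
  -- coordinates make up T.
  let Ψ : P × P → AE E × AE E := fun p => ((1, σ p.1), (0, σ p.2))
  have hΨ : Continuous Ψ := by
    refine Continuous.prodMk (Continuous.prodMk continuous_const (hσ.comp continuous_fst))
      (Continuous.prodMk continuous_const (hσ.comp continuous_snd))
  have h1 : Φ (Ψ (1, 0)) = 1 :=
    algebraMap_one_add_zero_smul (R := AE E) ((1 : AE E) ⊗ₜ[E] δ)
  have hW : (Φ ∘ Ψ) ⁻¹' U ∈ 𝓝 ((1, 0) : P × P) :=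
    (hΦ.comp hΨ).continuousAt.preimage_mem_nhds (by rw [Function.comp_apply, h1]; exact hU)
  rw [nhds_prod_eq, Filter.mem_prod_iff] at hW
  obtain ⟨U1, hU1, U2, hU2, hsub⟩ := hW
  rw [nhds_pi, Filter.mem_pi] at hU1 hU2
  obtain ⟨I1, hI1, t1, ht1, hs1⟩ := hU1
  obtain ⟨I2, hI2, t2, ht2, hs2⟩ := hU2
  classical
  refine ⟨hI1.toFinset ∪ hI2.toFinset, fun a b hinf hT hint => ?_⟩
  let p : P × P := (fun v => ⟨compFin v a, (hint v).1⟩, fun v => ⟨compFin v b, (hint v).2⟩)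
  have hp : Ψ p = (a, b) := by
    refine Prod.ext (adele_ext (fun v => (hinf v).1.symm) fun v => rfl)
      (adele_ext (fun v => (hinf v).2.symm) fun v => rfl)
  have hmem : p ∈ (Φ ∘ Ψ) ⁻¹' U := by
    refine hsub ⟨hs1 fun v hv => ?_, hs2 fun v hv => ?_⟩
    · have : p.1 v = 1 := Subtype.ext (hT v (by simp [hv])).1
      rw [this]; exact mem_of_mem_nhds (ht1 v)
    · have : p.2 v = 0 := Subtype.ext (hT v (by simp [hv])).2
      rw [this]; exact mem_of_mem_nhds (ht2 v)
  have : Φ (a, b) ∈ U := by rw [← hp]; exact hmem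
  simpa [Φ] using this

/-- The unit group of `ℂ` has no small subgroups. -/
theorem eq_one_of_forall_norm_pow_sub_one_le {z : ℂ} (h : ∀ k : ℕ, ‖z ^ k - 1‖ ≤ 1 / 2) :
    z = 1 := by
  by_contra hz
  have h0 : 0 < ‖z - 1‖ := norm_pos_iff.2 (sub_ne_zero.2 hz)
  -- Squaring w = z^(2^m) multiplies w - 1 by w + 1. As w is within 1/2 of 1, this factor has norm
  -- at least 3/2, so the distance to 1 would grow without bound.
  have key : ∀ m : ℕ, (3 / 2 : ℝ) ^ m * ‖z - 1‖ ≤ ‖z ^ (2 ^ m) - 1‖ := by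
    intro m
    induction m with
    | zero => simp
    | succ m ih =>
      have hfac : z ^ (2 ^ (m + 1)) - 1 = (z ^ (2 ^ m) + 1) * (z ^ (2 ^ m) - 1) := by
        rw [pow_succ, pow_mul]; ring
      have hge : (3 / 2 : ℝ) ≤ ‖z ^ (2 ^ m) + 1‖ := by
        have h2 : (2 : ℂ) = (z ^ (2 ^ m) + 1) - (z ^ (2 ^ m) - 1) := by ring
        have h3 := norm_sub_le (z ^ (2 ^ m) + 1) (z ^ (2 ^ m) - 1)
        rw [← h2, Complex.norm_two] at h3
        linarith [h (2 ^ m)]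
      rw [hfac, norm_mul, pow_succ, mul_comm _ (3 / 2 : ℝ), mul_assoc]
      exact mul_le_mul hge ih (by positivity) (by positivity)
  obtain ⟨m, hm⟩ := pow_unbounded_of_one_lt (1 / ‖z - 1‖) (by norm_num : (1 : ℝ) < 3 / 2)
  rw [div_lt_iff₀ h0] at hm
  linarith [key m, h (2 ^ m)]

end Components

/-! ### Hecke characters as products of local characters -/

section Hecke

variable {E K : Type*} [Field E] [Field K] [Algebra E K] [NumberField E]
  [Algebra.IsQuadraticExtension E K] {ε : K ≃ₐ[E] K}

open Topology

/-- A Hecke character is trivial on the units that are `1` at the infinite and at finitely many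
finite places and integral at the others. -/
theorem HeckeChar.exists_finset_forall_eq_one (χ : HeckeChar E K) (hε : ε ≠ 1) {δ : K}
    (h0 : δ ≠ 0) (hδ : ε δ = -δ) :
    ∃ T : Finset (HeightOneSpectrum (𝓞 E)), ∀ y : (AE E ⊗[E] K)ˣ,
      (∀ v, unitsBaseMap K (compInf v) y = 1) → (∀ v ∈ T, unitsBaseMap K (compFin v) y = 1) →
      (∀ v, (unitsBaseMap K (compFin v) y : _ ⊗[E] K) ∈ localOrder δ v ∧
        (((unitsBaseMap K (compFin v) y)⁻¹ : (_ ⊗[E] K)ˣ) : _ ⊗[E] K) ∈ localOrder δ v) →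
      χ.toHom y = 1 := by
  let : TopologicalSpace (AE E ⊗[E] K) := moduleTopology (AE E) (AE E ⊗[E] K)
  have : IsModuleTopology (AE E) (AE E ⊗[E] K) := ⟨rfl⟩
  obtain ⟨d, hd⟩ := exists_algebraMap_eq_of_fixed hε (x := δ * δ) (by simp [hδ])
  -- This neighbourhood of 1 contains no nontrivial subgroup of ℂˣ, so it is enough to bring all
  -- powers of y into its preimage.
  have hV : {z : ℂˣ | ‖(z : ℂ) - 1‖ < 1 / 2} ∈ 𝓝 (χ.toHom 1) := by
    refine (isOpen_lt (by fun_prop) continuous_const).mem_nhds ?_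
    simp
  have hW := χ.continuous_toHom.continuousAt.preimage_mem_nhds hV
  -- The topology of the unit group is induced by y ↦ (y, y⁻¹), so integrality has to be controlled
  -- for the inverse as well.
  rw [Units.isEmbedding_embedProduct.toIsInducing.nhds_eq_comap, Filter.mem_comap] at hW
  obtain ⟨W, hW, hsub⟩ := hW
  rw [map_one, Prod.one_eq_mk, nhds_prod_eq, Filter.mem_prod_iff] at hW
  obtain ⟨U1, hU1, U2, hU2, hUW⟩ := hW
  obtain ⟨T1, hT1⟩ := exists_finset_forall_mem_of_mem_nhds_one hU1 δ
  obtain ⟨T2, hT2⟩ := exists_finset_forall_mem_of_mem_nhds_one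
    (MulOpposite.continuous_op.continuousAt.preimage_mem_nhds hU2) δ
  have hD := Filter.eventually_cofinite.1 (eventually_algebraMap_mem d)
  classical
  have key : ∀ y : (AE E ⊗[E] K),
      (∀ v, baseMap (compInf v) K y = 1) →
      (∀ v ∈ T1 ∪ T2, baseMap (compFin v) K y = 1) →
      (∀ v, baseMap (compFin v) K y ∈ localOrder δ v) → y ∈ U1 ∧ MulOpposite.op y ∈ U2 := by
    intro y hy1 hy2 hy3
    obtain ⟨a, b, rfl⟩ := exists_eq_algebraMap_add (R := AE E) hε h0 hδ y
    simp only [baseMap_algebraMap_add_smul_tmul] at hy1 hy2 hy3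
    have ha : ∀ v, compInf v a = 1 ∧ compInf v b = 0 := fun v =>
      algebraMap_add_smul_tmul_inj h0 hδ ((hy1 v).trans (algebraMap_one_add_zero_smul _).symm)
    have hb : ∀ v ∈ T1 ∪ T2, compFin v a = 1 ∧ compFin v b = 0 := fun v hv =>
      algebraMap_add_smul_tmul_inj h0 hδ ((hy2 v hv).trans (algebraMap_one_add_zero_smul _).symm)
    have hc : ∀ v, compFin v a ∈ v.adicCompletionIntegers E ∧
        compFin v b ∈ v.adicCompletionIntegers E := fun v => by
      obtain ⟨a', ha', b', hb', h⟩ := hy3 v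
      obtain ⟨h1, h2⟩ := algebraMap_add_smul_tmul_inj h0 hδ h
      exact ⟨h1 ▸ ha', h2 ▸ hb'⟩
    exact ⟨hT1 a b ha (fun v hv => hb v (Finset.mem_union_left _ hv)) hc,
      hT2 a b ha (fun v hv => hb v (Finset.mem_union_right _ hv)) hc⟩
  -- The places where d = δ² is not integral are included because `localOrder` need not be stable
  -- under powers there; y is required to be 1 at them.
  refine ⟨T1 ∪ T2 ∪ hD.toFinset, fun y hy1 hy2 hy3 => ?_⟩
  have hpow : ∀ k : ℕ, y ^ k ∈ χ.toHom ⁻¹' {z : ℂˣ | ‖(z : ℂ) - 1‖ < 1 / 2} := by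
    intro k
    have hmem : ∀ z : (AE E ⊗[E] K)ˣ, (∀ v, unitsBaseMap K (compInf v) z = 1) →
        (∀ v ∈ T1 ∪ T2 ∪ hD.toFinset, unitsBaseMap K (compFin v) z = 1) →
        (∀ v, (unitsBaseMap K (compFin v) z : _ ⊗[E] K) ∈ localOrder δ v) →
        ((z ^ k : (AE E ⊗[E] K)ˣ) : AE E ⊗[E] K) ∈ U1 ∧
          MulOpposite.op ((z ^ k : (AE E ⊗[E] K)ˣ) : AE E ⊗[E] K) ∈ U2 := by
      intro z hz1 hz2 hz3
      refine key _ (fun v => ?_) (fun v hv => ?_) (fun v => ?_)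
      · rw [← unitsBaseMap_val, map_pow, hz1, one_pow, Units.val_one]
      · rw [← unitsBaseMap_val, map_pow, hz2 v (Finset.mem_union_left _ hv), one_pow,
          Units.val_one]
      · rw [← unitsBaseMap_val, map_pow]
        by_cases hv : v ∈ hD.toFinset
        · rw [hz2 v (Finset.mem_union_right _ hv), one_pow]
          exact one_mem_localOrder δ v
        · rw [Set.Finite.mem_toFinset, Set.mem_ofPred_eq, not_not] at hv
          rw [Units.val_pow_eq_pow_val]
          exact pow_mem_localOrder hd hv (hz3 v) k
    refine hsub (hUW ⟨(hmem y hy1 hy2 fun v => (hy3 v).1).1, ?_⟩)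
    have := (hmem y⁻¹ (fun v => by rw [map_inv, hy1, inv_one])
      (fun v hv => by rw [map_inv, hy2 v hv, inv_one])
      fun v => by rw [map_inv]; exact (hy3 v).2).2
    rw [inv_pow] at this
    exact this
  apply Units.ext
  refine eq_one_of_forall_norm_pow_sub_one_le fun k => ?_
  have := hpow k
  rw [Set.mem_preimage, map_pow] at this
  exact le_of_lt (by simpa using this)

/-- A Hecke character is the product of its local components. -/
theorem HeckeChar.eq_prod (χ : HeckeChar E K) (hε : ε ≠ 1) (x : (AE E ⊗[E] K)ˣ) :
    (∀ᶠ v in Filter.cofinite, χ.atFin v (unitsBaseMap K (compFin v) x) = 1) ∧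
    χ.toHom x = (∏ v, χ.atInf v (unitsBaseMap K (compInf v) x)) *
      ∏ᶠ v, χ.atFin v (unitsBaseMap K (compFin v) x) := by
  classical
  obtain ⟨δ, h0, hδ⟩ := exists_antiinvariant ε hε
  obtain ⟨T, hT⟩ := χ.exists_finset_forall_eq_one hε h0 hδ
  have hord : ∀ y : AE E ⊗[E] K, ∀ᶠ v in Filter.cofinite,
      baseMap (compFin v) K y ∈ localOrder δ v := by
    intro y
    obtain ⟨a, b, rfl⟩ := exists_eq_algebraMap_add (R := AE E) hε h0 hδ y
    filter_upwards [eventually_compFin_mem a, eventually_compFin_mem b] with v ha hb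
    exact ⟨_, ha, _, hb, baseMap_algebraMap_add_smul_tmul _ _ _ _⟩
  have hB := Filter.eventually_cofinite.1
    ((hord x).and (hord ((x⁻¹ : (AE E ⊗[E] K)ˣ) : AE E ⊗[E] K)))
  let S := T ∪ hB.toFinset
  have hS : ∀ v ∉ S, baseMap (compFin v) K (x : AE E ⊗[E] K) ∈ localOrder δ v ∧
      baseMap (compFin v) K ((x⁻¹ : (AE E ⊗[E] K)ˣ) : AE E ⊗[E] K) ∈ localOrder δ v := by
    intro v hv
    by_contra h
    exact hv (Finset.mem_union_right _ (by simpa using h))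
  let eI : InfinitePlace E → (AE E ⊗[E] K)ˣ := fun v =>
    extendByOne K (inclInf v) (inclInf_mul v) (unitsBaseMap K (compInf v) x)
  let eF : HeightOneSpectrum (𝓞 E) → (AE E ⊗[E] K)ˣ := fun v =>
    extendByOne K (inclFin v) (inclFin_mul v) (unitsBaseMap K (compFin v) x)
  have hII : ∀ v, unitsBaseMap K (compInf v) (eI v) = unitsBaseMap K (compInf v) x := fun v =>
    unitsBaseMap_extendByOne_self _ _ _ (compInf_inclInf_self v) _
  have hII' : ∀ v w, w ≠ v → unitsBaseMap K (compInf w) (eI v) = 1 := fun v w h =>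
    unitsBaseMap_extendByOne_of_eq_zero _ _ _ (compInf_inclInf_of_ne h) _
  have hFF : ∀ v, unitsBaseMap K (compFin v) (eF v) = unitsBaseMap K (compFin v) x := fun v =>
    unitsBaseMap_extendByOne_self _ _ _ (compFin_inclFin_self v) _
  have hFF' : ∀ v w, w ≠ v → unitsBaseMap K (compFin w) (eF v) = 1 := fun v w h =>
    unitsBaseMap_extendByOne_of_eq_zero _ _ _ (compFin_inclFin_of_ne h) _
  have hIF : ∀ v w, unitsBaseMap K (compFin w) (eI v) = 1 := fun v w =>
    unitsBaseMap_extendByOne_of_eq_zero _ _ _ (compFin_inclInf v w) _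
  have hFI : ∀ v w, unitsBaseMap K (compInf w) (eF v) = 1 := fun v w =>
    unitsBaseMap_extendByOne_of_eq_zero _ _ _ (compInf_inclFin v w) _
  -- For v outside S the idele with component x_v at v and 1 elsewhere already satisfies the
  -- conditions of `hT`.
  have hone : ∀ v ∉ S, χ.atFin v (unitsBaseMap K (compFin v) x) = 1 := by
    intro v hv
    refine hT (eF v) (hFI v) (fun w hw => hFF' v w ?_) (fun w => ?_)
    · rintro rfl; exact hv (Finset.mem_union_left _ hw)
    · by_cases hwv : w = v
      · subst hwv
        rw [hFF]; exact hS w hv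
      · rw [hFF' v w hwv, inv_one]
        exact ⟨one_mem_localOrder δ w, one_mem_localOrder δ w⟩
  refine ⟨?_, ?_⟩
  · rw [Filter.eventually_cofinite]
    exact S.finite_toSet.subset fun v hv => by_contra fun h => hv (hone v h)
  have hfin : (∏ᶠ v, χ.atFin v (unitsBaseMap K (compFin v) x)) = ∏ v ∈ S, χ.toHom (eF v) :=
    finprod_eq_prod_of_mulSupport_subset _ fun v hv => by_contra fun h => hv (hone v h)
  -- Dividing x by its components at infinity and at S leaves an idele that is 1 there and agrees
  -- with x elsewhere, so χ is trivial on it by `hT`.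
  have hcF : ∀ w, unitsBaseMap K (compFin w) (x * (∏ v, eI v)⁻¹ * (∏ v ∈ S, eF v)⁻¹) =
      if w ∈ S then 1 else unitsBaseMap K (compFin w) x := by
    intro w
    rw [map_mul, map_mul, map_inv, map_inv, map_prod, map_prod,
      Finset.prod_eq_one fun v _ => hIF v w, inv_one, mul_one]
    split_ifs with hw
    · rw [Finset.prod_eq_single w (fun v _ h => hFF' v w h.symm) (fun h => absurd hw h), hFF,
        mul_inv_cancel]
    · rw [Finset.prod_eq_one fun v hv => hFF' v w fun h => hw (h ▸ hv), inv_one, mul_one]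
  have hy := hT (x * (∏ v, eI v)⁻¹ * (∏ v ∈ S, eF v)⁻¹) ?_ ?_ ?_
  · rw [map_mul, map_mul, map_inv, map_inv, map_prod, map_prod, mul_inv_eq_one,
      mul_inv_eq_iff_eq_mul, mul_comm] at hy
    rw [hfin]
    exact hy
  · intro w
    rw [map_mul, map_mul, map_inv, map_inv, map_prod, map_prod,
      Finset.prod_eq_one fun v _ => hFI v w, Finset.prod_eq_single w
        (fun v _ h => hII' v w h.symm) (fun h => absurd (Finset.mem_univ w) h), hII]
    simp
  · intro w hw
    rw [hcF, if_pos (Finset.mem_union_left _ hw)]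
  · intro w
    rw [hcF]
    split_ifs with hw
    · rw [inv_one]
      exact ⟨one_mem_localOrder δ w, one_mem_localOrder δ w⟩
    · exact hS w hw

end Hecke

/-! ### Compatibility with base change along `R → S` -/

section BaseChange

variable {E K : Type*} [Field E] [Field K] [Algebra E K] {ε : K ≃ₐ[E] K} {n : ℕ}
variable {R S : Type*} [CommRing R] [CommRing S] [Algebra E R] [Algebra E S] (π : R →ₐ[E] S)

/-- The base change `GL_n(R ⊗ K) → GL_n(S ⊗ K)`. -/
def glBaseMap : GL (Fin n) (R ⊗[E] K) →* GL (Fin n) (S ⊗[E] K) :=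
  Matrix.GeneralLinearGroup.map (baseMap π K : (R ⊗[E] K) →+* (S ⊗[E] K))

theorem glBaseMap_val (h : GL (Fin n) (R ⊗[E] K)) :
    (glBaseMap π h).val = h.val.map (baseMap π K) := rfl

theorem ctGL_glBaseMap (h : GL (Fin n) (R ⊗[E] K)) :
    ctGL ε (glBaseMap π h) = glBaseMap π (ctGL ε h) :=
  Units.ext (baseMap_ct (ε := ε) (π := π) h.val).symm

theorem det_glBaseMap (h : GL (Fin n) (R ⊗[E] K)) :
    Matrix.GeneralLinearGroup.det (glBaseMap π h) =
      unitsBaseMap K π (Matrix.GeneralLinearGroup.det h) :=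
  Units.ext (AlgHom.map_det (baseMap π K) h.val).symm

theorem baseMap_algebraMap (a : R) :
    baseMap π K (algebraMap R (R ⊗[E] K) a) = algebraMap S (S ⊗[E] K) (π a) := by
  simp [baseMap, Algebra.TensorProduct.algebraMap_apply]

theorem map_baseMap_smul {m : Type*} (a : R) (M : Matrix m m (R ⊗[E] K)) :
    (a • M).map (baseMap π K) = π a • M.map (baseMap π K) := by
  ext i j
  simp only [Matrix.map_apply, Matrix.smul_apply, Algebra.smul_def, map_mul, baseMap_algebraMap]

theorem GU.map_one : GU.map ε π (1 : GU ε n R) = 1 :=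
  Subtype.ext (_root_.map_one (Matrix.GeneralLinearGroup.map
    (baseMap π K : (R ⊗[E] K) →+* (S ⊗[E] K))))

variable [Algebra.IsQuadraticExtension E K]

theorem GU.map_mGU (h : GL (Fin n) (R ⊗[E] K)) (l : Rˣ) :
    GU.map ε π (mGU ε h l) = mGU ε (glBaseMap π h) (Units.map (π : R →* S) l) := by
  apply Subtype.ext
  apply Units.ext
  change (Matrix.fromBlocks (ct ε (h⁻¹).val) 0 0 ((l : R) • h.val)).map (baseMap π K) =
    Matrix.fromBlocks (ct ε ((glBaseMap π h)⁻¹).val) 0 0 (π l • (glBaseMap π h).val)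
  rw [Matrix.fromBlocks_map, ← map_inv, glBaseMap_val, glBaseMap_val, baseMap_ct,
    map_baseMap_smul, Matrix.map_zero _ (map_zero _)]

/-- The element `det(ᵗh̄⁻¹ h⁻¹)` of the base ring. -/
def hermNorm (ε : K ≃ₐ[E] K) (h : GL (Fin n) (R ⊗[E] K)) : R :=
  toBase (((ctGL ε h⁻¹).val * (h⁻¹).val).det)

variable [CharZero E]

/-- The matrix ᵗh̄⁻¹ h⁻¹ is Hermitian, so its determinant is fixed by the involution and `toBase`
loses nothing. -/
theorem algebraMap_hermNorm (hε : ε ≠ 1) (h : GL (Fin n) (R ⊗[E] K)) :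
    algebraMap R (R ⊗[E] K) (hermNorm ε h) = ((ctGL ε h⁻¹).val * (h⁻¹).val).det := by
  refine algebraMap_toBase hε ?_
  rw [conj_det, ct_mul]
  change (ct ε h⁻¹.val * ct ε (ct ε h⁻¹.val)).det = (ct ε h⁻¹.val * h⁻¹.val).det
  rw [ct_ct]

/-- This links the factor det(ᵗh̄ h) in the determinant of the substitution to the quantity in the
final formula, its inverse; it also shows that `hermNorm` is a unit. -/
theorem hermNorm_mul_toBase (hε : ε ≠ 1) (h : GL (Fin n) (R ⊗[E] K)) :
    hermNorm ε h * toBase (ct ε h.val * h.val).det = 1 := by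
  apply algebraMap_tensor_injective (E := E) (K := K)
  have h1 : ct ε h⁻¹.val * ct ε h.val = 1 := by rw [← ct_mul, ← Units.val_mul]; simp [ct_one]
  have h2 : h⁻¹.val * h.val = 1 := by rw [← Units.val_mul]; simp
  have h1' := congrArg Matrix.det h1
  have h2' := congrArg Matrix.det h2
  rw [Matrix.det_mul, Matrix.det_one] at h1' h2'
  rw [map_mul, algebraMap_hermNorm hε, algebraMap_toBase hε, map_one, Matrix.det_mul,
    Matrix.det_mul]
  · change (ct ε h⁻¹.val).det * _ * _ = 1
    linear_combination (h⁻¹.val.det * h.val.det) * h1' + h2'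
  · rw [conj_det, ct_mul, ct_ct]

theorem map_hermNorm (hε : ε ≠ 1) (h : GL (Fin n) (R ⊗[E] K)) :
    hermNorm ε (glBaseMap π h) = π (hermNorm ε h) := by
  apply algebraMap_tensor_injective (E := E) (K := K)
  rw [algebraMap_hermNorm hε, ← baseMap_algebraMap, algebraMap_hermNorm hε, ← map_inv,
    ctGL_glBaseMap, ← Units.val_mul, ← Units.val_mul, ← map_mul, glBaseMap_val, AlgHom.map_det,
    AlgHom.mapMatrix_apply]

end BaseChange

/-! ### The local change of variables -/

section Local

variable {E K : Type*} [Field E] [Field K] [Algebra E K] {ε : K ≃ₐ[E] K} {n : ℕ}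
  [Algebra.IsQuadraticExtension E K]

/-- After the Levi element is moved to the left, the section law applies with a = det ᵗh̄⁻¹, and
then a ā = det(ᵗh̄⁻¹ h⁻¹). -/
theorem IsLocalSection.apply_eta_mul {F : Type*} [NormedField F] [Algebra E F]
    {χ : (F ⊗[E] K)ˣ →* ℂˣ} {s : ℂ} {f : GU ε n F → ℂ} (hf : IsLocalSection ε χ s f)
    (h : GL (Fin n) (F ⊗[E] K)) (l : Fˣ) (b : Her ε n F) :
    f (etaGU ε * nGU ε b * mGU ε h l) =
      (χ (Matrix.GeneralLinearGroup.det (ctGL ε h⁻¹)) : ℂ) *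
        ((‖hermNorm ε h‖ : ℝ) : ℂ) ^ (-s) * f (etaGU ε * nGU ε (hermTwist ε h l b)) := by
  rw [etaGU_mul_nGU_mul_mGU, hf, smulGL_inv_smulGL_ctGL, conj_det, hermNorm, Matrix.det_mul]
  have : ct ε (ctGL ε h⁻¹).val = h⁻¹.val := ct_ct _
  rw [this]

/-- The factor by which a local Fourier coefficient changes. -/
def localFactor {F : Type*} [NormedField F] [Algebra E F] (ε : K ≃ₐ[E] K)
    (χ : (F ⊗[E] K)ˣ →* ℂˣ) (s : ℂ)
    (h : GL (Fin n) (F ⊗[E] K)) (l : Fˣ) : ℂ :=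
  ((‖(l : F)‖ : ℝ) : ℂ) ^ (-((n : ℤ) ^ 2)) *
    (χ (Matrix.GeneralLinearGroup.det (ctGL ε h⁻¹)) : ℂ) *
    ((‖hermNorm ε h‖ : ℝ) : ℂ) ^ ((n : ℂ) - s)

/-- The twist of β is dual to the twist of b under the trace pairing: ᵗh̄⁻¹ cancels ᵗh̄ in the
middle, and cyclicity brings h next to h⁻¹. -/
theorem trace_mul_hermTwist {R : Type*} [CommRing R] [Algebra E R] (h : GL (Fin n) (R ⊗[E] K))
    (l : Rˣ) (B : Matrix (Fin n) (Fin n) (R ⊗[E] K)) (b : Her ε n R) :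
    ((((l⁻¹ : Rˣ) : R) • (h⁻¹.val * B * (ctGL ε h⁻¹).val)) * (hermTwist ε h l b).mat).trace =
      (B * b.mat).trace := by
  have h1 : (ctGL ε h⁻¹).val * ct ε h.val = 1 := by
    change ct ε h⁻¹.val * ct ε h.val = 1
    rw [← ct_mul, ← Units.val_mul]; simp [ct_one]
  have h2 : h.val * h⁻¹.val = 1 := by rw [← Units.val_mul]; simp
  have h3 : h⁻¹.val * B * (ctGL ε h⁻¹).val * (ct ε h.val * b.mat * h.val) =
      h⁻¹.val * (B * ((ctGL ε h⁻¹).val * ct ε h.val) * b.mat * h.val) := by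
    simp only [Matrix.mul_assoc]
  rw [hermTwist_mat, Matrix.smul_mul, Matrix.mul_smul, smul_smul, Units.inv_mul, one_smul, h3, h1,
    Matrix.mul_one, Matrix.trace_mul_comm, Matrix.mul_assoc, h2, Matrix.mul_one]

variable [CharZero E]

theorem hermNorm_ne_zero {F : Type*} [NormedField F] [Algebra E F] (hε : ε ≠ 1)
    (h : GL (Fin n) (F ⊗[E] K)) : hermNorm ε h ≠ 0 :=
  left_ne_zero_of_mul_eq_one (hermNorm_mul_toBase hε h)

theorem localFactor_ne_zero {F : Type*} [NormedField F] [Algebra E F] (hε : ε ≠ 1)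
    (χ : (F ⊗[E] K)ˣ →* ℂˣ) (s : ℂ) (h : GL (Fin n) (F ⊗[E] K)) (l : Fˣ) :
    localFactor ε χ s h l ≠ 0 := by
  refine mul_ne_zero (mul_ne_zero (zpow_ne_zero _ ?_) (Units.ne_zero _)) ?_
  · simp
  · rw [Complex.cpow_ne_zero_iff]
    simp [hermNorm_ne_zero hε]

variable {F : Type*} [NormedField F] [Algebra E F] [LocallyCompactSpace F]
  [SecondCountableTopology F] [MeasurableSpace F] [BorelSpace F]

/-- Push-forward scales by the inverse of |det|, and inverting det(ᵗh̄ h)^n produces `hermNorm` to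
the power n. The same normalizing constant stands on both sides, whatever the set B is. -/
theorem map_hermTwist_haarNormalized (hε : ε ≠ 1) (hF : NormIsModulus F)
    (h : GL (Fin n) (F ⊗[E] K)) (l : Fˣ) (B : Set (Her ε n F)) :
    (haarNormalized ε B).map (hermTwist ε h l) =
      (‖(l : F)‖ₑ⁻¹ ^ n ^ 2 * ‖hermNorm ε h‖ₑ ^ n) • haarNormalized ε B := by
  have : FiniteDimensional E K :=
    Module.finite_of_finrank_eq_succ (Algebra.IsQuadraticExtension.finrank_eq_two E K)
  have : FiniteDimensional F (Her ε n F) :=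
    inferInstanceAs (FiniteDimensional F (hermSubmodule ε n F))
  have ht : ‖hermNorm ε h‖ₑ * ‖toBase (ct ε h.val * h.val).det‖ₑ = 1 := by
    rw [← enorm_mul, hermNorm_mul_toBase hε, enorm_one]
  have ht' : ‖toBase (ct ε h.val * h.val).det‖ₑ⁻¹ = ‖hermNorm ε h‖ₑ :=
    (ENNReal.eq_inv_of_mul_eq_one_left ht).symm
  rw [haarNormalized, Measure.map_smul, map_linearEquiv_addHaar hF, smul_comm, det_hermTwist hε,
    enorm_mul, enorm_pow, enorm_pow, ENNReal.mul_inv, ENNReal.inv_pow, ENNReal.inv_pow, ht']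
  · exact .inl (pow_ne_zero _ (enorm_ne_zero.2 l.ne_zero))
  · exact .inl (ENNReal.pow_ne_top enorm_ne_top)

/-- The integrand at m is a nonzero constant times the integrand at 1 composed with the
substitution. The constant carries |N|^{-s} and the measure |N|^n, whence the exponent n - s. As the
substitution is a homeomorphism, integrability is equivalent on both sides without measurability
assumptions on f. -/
theorem integrable_and_integral_local (hε : ε ≠ 1) (hF : NormIsModulus F)
    {χ : (F ⊗[E] K)ˣ →* ℂˣ} {s : ℂ} {f : GU ε n F → ℂ} (hf : IsLocalSection ε χ s f)
    (h : GL (Fin n) (F ⊗[E] K)) (l : Fˣ) (B : Matrix (Fin n) (Fin n) (F ⊗[E] K)) (ψ : F → ℂ)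
    (D : Set (Her ε n F)) {I J : Her ε n F → ℂ}
    (hI : ∀ b, I b = f (etaGU ε * nGU ε b * mGU ε h l) * ψ (-toBase (B * b.mat).trace))
    (hJ : ∀ b, J b = f (etaGU ε * nGU ε b * 1) * ψ (-toBase
      ((((l⁻¹ : Fˣ) : F) • (h⁻¹.val * B * (ctGL ε h⁻¹).val)) * b.mat).trace)) :
    (Integrable I (haarNormalized ε D) ↔ Integrable J (haarNormalized ε D)) ∧
    ∫ b, I b ∂(haarNormalized ε D) =
      localFactor ε χ s h l * ∫ b, J b ∂(haarNormalized ε D) := by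
  set c : ℂ := (χ (Matrix.GeneralLinearGroup.det (ctGL ε h⁻¹)) : ℂ) *
        ((‖hermNorm ε h‖ : ℝ) : ℂ) ^ (-s) with hc
  have h0 := hermNorm_ne_zero hε h
  have hn0 : ((‖hermNorm ε h‖ : ℝ) : ℂ) ≠ 0 := by simp [h0]
  have hc0 : c ≠ 0 := by
    refine mul_ne_zero (Units.ne_zero _) ?_
    rw [Complex.cpow_ne_zero_iff]
    exact .inl hn0
  have hIJ : I = fun b => c * J (hermTwist ε h l b) := by
    funext b
    rw [hI, hJ, hf.apply_eta_mul, trace_mul_hermTwist, mul_one, mul_assoc]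
  let H : Her ε n F ≃ₜ Her ε n F :=
    ⟨(hermTwist ε h l).toEquiv,
      IsModuleTopology.continuous_of_linearMap (hermTwist ε h l).toLinearMap,
      IsModuleTopology.continuous_of_linearMap (hermTwist ε h l).symm.toLinearMap⟩
  let e := H.toMeasurableEquiv
  have hmap : (haarNormalized ε D).map e = _ • haarNormalized ε D :=
    map_hermTwist_haarNormalized hε hF h l D
  set k := ‖(l : F)‖ₑ⁻¹ ^ n ^ 2 * ‖hermNorm ε h‖ₑ ^ n with hk
  have hl0 : ‖(l : F)‖ₑ ≠ 0 := enorm_ne_zero.2 l.ne_zero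
  have hk0 : k ≠ 0 := mul_ne_zero (pow_ne_zero _ (ENNReal.inv_ne_zero.2 enorm_ne_top))
    (pow_ne_zero _ (enorm_ne_zero.2 h0))
  have hktop : k ≠ ⊤ := ENNReal.mul_ne_top (ENNReal.pow_ne_top (ENNReal.inv_ne_top.2 hl0))
    (ENNReal.pow_ne_top enorm_ne_top)
  rw [hIJ]
  constructor
  · rw [integrable_const_mul_iff (isUnit_iff_ne_zero.2 hc0)]
    change Integrable (J ∘ e) _ ↔ _
    rw [← integrable_map_equiv, hmap, integrable_smul_measure hk0 hktop]
  · rw [integral_const_mul]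
    have := integral_map_equiv (μ := haarNormalized ε D) e J
    change c * ∫ b, J (e b) ∂_ = _
    rw [← this, hmap, integral_smul_measure, Complex.real_smul, ← mul_assoc]
    congr 1
    rw [hc, hk, localFactor, ENNReal.toReal_mul, ENNReal.toReal_pow, ENNReal.toReal_pow,
      ENNReal.toReal_inv, toReal_enorm, toReal_enorm, sub_eq_add_neg, Complex.cpow_add _ _ hn0,
      Complex.cpow_natCast, zpow_neg, ← Nat.cast_pow, zpow_natCast]
    push_cast
    rw [inv_pow]
    ring

end Local

/-! ### Assembling the local factors -/

section Global

variable {E K : Type*} [Field E] [Field K] [Algebra E K] {ε : K ≃ₐ[E] K} {n : ℕ}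

theorem map_smul_inv_mul_mul {R S : Type*} [CommRing R] [CommRing S] [Algebra E R] [Algebra E S]
    (π : R →ₐ[E] S) (h : GL (Fin n) (R ⊗[E] K)) (l : Rˣ)
    (B : Matrix (Fin n) (Fin n) (R ⊗[E] K)) :
    (((l⁻¹ : Rˣ) : R) • (h⁻¹.val * B * (ctGL ε h⁻¹).val)).map (baseMap π K) =
      (((Units.map (π : R →* S) l)⁻¹ : Sˣ) : S) • ((glBaseMap π h)⁻¹.val * B.map (baseMap π K) *
        (ctGL ε (glBaseMap π h)⁻¹).val) := by
  rw [map_baseMap_smul, Matrix.map_mul, Matrix.map_mul, ← map_inv, ← map_inv, ctGL_glBaseMap]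
  rfl

variable [NumberField E] [Algebra.IsQuadraticExtension E K]
variable {χ : HeckeChar E K} {s : ℂ}

theorem coeffInf_mGU [NumberField K] [IsTotallyReal E] (hε : ε ≠ 1) (f : SiegelSection ε n χ s)
    (h : GL (Fin n) (AE E ⊗[E] K)) (l : (AE E)ˣ) (B : Matrix (Fin n) (Fin n) (AE E ⊗[E] K))
    (v : InfinitePlace E) :
    (Integrable (integrandInf B (mGU ε h l) f v) (measInf ε n v) ↔
      Integrable (integrandInf (((l⁻¹ : (AE E)ˣ) : AE E) • (h⁻¹.val * B * (ctGL ε h⁻¹).val)) 1 f v)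
        (measInf ε n v)) ∧
    coeffInf B (mGU ε h l) f v =
      localFactor ε (χ.atInf v) s (glBaseMap (compInf v) h)
        (Units.map (compInf v : AE E →* v.Completion) l) *
      coeffInf (((l⁻¹ : (AE E)ˣ) : AE E) • (h⁻¹.val * B * (ctGL ε h⁻¹).val)) 1 f v := by
  let : MeasurableSpace v.Completion := borel _
  have : BorelSpace v.Completion := ⟨rfl⟩
  refine integrable_and_integral_local hε (normIsModulus_completion v)
    (f.isLocalSection_atInf v) (glBaseMap (compInf v) h)
    (Units.map (compInf v : AE E →* v.Completion) l) (B.map (baseMap (compInf v) K)) (charInf v) _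
    (fun b => ?_) (fun b => ?_)
  · rw [integrandInf, GU.map_mGU]
  · rw [integrandInf, GU.map_one, map_smul_inv_mul_mul]

theorem coeffFin_mGU (hε : ε ≠ 1) (f : SiegelSection ε n χ s)
    (h : GL (Fin n) (AE E ⊗[E] K)) (l : (AE E)ˣ) (B : Matrix (Fin n) (Fin n) (AE E ⊗[E] K))
    (v : HeightOneSpectrum (𝓞 E)) :
    (Integrable (integrandFin B (mGU ε h l) f v) (measFin ε n v) ↔
      Integrable (integrandFin (((l⁻¹ : (AE E)ˣ) : AE E) • (h⁻¹.val * B * (ctGL ε h⁻¹).val)) 1 f v)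
        (measFin ε n v)) ∧
    coeffFin B (mGU ε h l) f v =
      localFactor ε (χ.atFin v) s (glBaseMap (compFin v) h)
        (Units.map (compFin v : AE E →* v.adicCompletion E) l) *
      coeffFin (((l⁻¹ : (AE E)ˣ) : AE E) • (h⁻¹.val * B * (ctGL ε h⁻¹).val)) 1 f v := by
  let : MeasurableSpace (v.adicCompletion E) := borel _
  have : BorelSpace (v.adicCompletion E) := ⟨rfl⟩
  refine integrable_and_integral_local hε (normIsModulus_adicCompletion v)
    (f.isLocalSection_atFin v) (glBaseMap (compFin v) h)
    (Units.map (compFin v : AE E →* v.adicCompletion E) l) (B.map (baseMap (compFin v) K))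
    (charFin v) _ (fun b => ?_) (fun b => ?_)
  · rw [integrandFin, GU.map_mGU]
  · rw [integrandFin, GU.map_one, map_smul_inv_mul_mul]

theorem localFactor_glBaseMap {F : Type*} [NormedField F] [Algebra E F] (hε : ε ≠ 1)
    (π : AE E →ₐ[E] F) (θ : (F ⊗[E] K)ˣ →* ℂˣ) (s : ℂ)
    (h : GL (Fin n) (AE E ⊗[E] K)) (l : (AE E)ˣ) :
    localFactor ε θ s (glBaseMap π h) (Units.map (π : AE E →* F) l) =
      ((‖π l‖ : ℝ) : ℂ) ^ (-((n : ℤ) ^ 2)) *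
      (θ (unitsBaseMap K π (Matrix.GeneralLinearGroup.det (ctGL ε h⁻¹))) : ℂ) *
      ((‖π (hermNorm ε h)‖ : ℝ) : ℂ) ^ ((n : ℂ) - s) := by
  rw [localFactor, map_hermNorm π hε, ← det_glBaseMap, ← ctGL_glBaseMap, map_inv]
  rfl

/-- Complex powers are multiplicative on nonnegative reals, where no branch problem arises; this
turns products of local absolute values into the adelic one. -/
theorem prod_ofReal_cpow {ι : Type*} (S : Finset ι) (r : ι → ℝ) (hr : ∀ i, 0 ≤ r i) (w : ℂ) :
    ∏ i ∈ S, ((r i : ℝ) : ℂ) ^ w = ((∏ i ∈ S, r i : ℝ) : ℂ) ^ w := by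
  classical
  induction S using Finset.induction_on with
  | empty => simp
  | insert i S hi ih =>
    rw [Finset.prod_insert hi, Finset.prod_insert hi, ih, Complex.ofReal_mul,
      Complex.mul_cpow_ofReal_nonneg (hr i) (Finset.prod_nonneg fun j _ => hr j)]

theorem isUnit_hermNorm (hε : ε ≠ 1) {R : Type*} [CommRing R] [Algebra E R]
    (h : GL (Fin n) (R ⊗[E] K)) : IsUnit (hermNorm ε h) :=
  IsUnit.of_mul_eq_one _ (hermNorm_mul_toBase hε h)

/-- Both λ and N are ideles, so their norms are 1 at almost all places, and almost all components of
χ are trivial on det ᵗh̄⁻¹. -/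
theorem eventually_localFactor_eq_one (hε : ε ≠ 1) (χ : HeckeChar E K) (s : ℂ)
    (h : GL (Fin n) (AE E ⊗[E] K)) (l : (AE E)ˣ) :
    ∀ᶠ v in Filter.cofinite, localFactor ε (χ.atFin v) s (glBaseMap (compFin v) h)
      (Units.map (compFin v : AE E →* v.adicCompletion E) l) = 1 := by
  filter_upwards [eventually_norm_compFin_eq_one l.isUnit,
    eventually_norm_compFin_eq_one (isUnit_hermNorm hε h),
    (χ.eq_prod hε (Matrix.GeneralLinearGroup.det (ctGL ε h⁻¹))).1] with v h1 h2 h3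
  rw [localFactor_glBaseMap hε, h1, h2, h3]
  simp

/-- The product of the local factors. -/
theorem prod_localFactor (hε : ε ≠ 1) (χ : HeckeChar E K) (s : ℂ)
    (h : GL (Fin n) (AE E ⊗[E] K)) (l : (AE E)ˣ) :
    (∏ v, localFactor ε (χ.atInf v) s (glBaseMap (compInf v) h)
        (Units.map (compInf v : AE E →* v.Completion) l)) *
      ∏ᶠ v, localFactor ε (χ.atFin v) s (glBaseMap (compFin v) h)
        (Units.map (compFin v : AE E →* v.adicCompletion E) l) =
      ((adelicAbs (l : AE E) : ℝ) : ℂ) ^ (-((n : ℤ) ^ 2)) *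
        (χ.toHom (Matrix.GeneralLinearGroup.det (ctGL ε h⁻¹)) : ℂ) *
        ((adelicAbs (hermNorm ε h) : ℝ) : ℂ) ^ ((n : ℂ) - s) := by
  have h1 := eventually_norm_compFin_eq_one l.isUnit
  have h2 := eventually_norm_compFin_eq_one (isUnit_hermNorm hε h)
  obtain ⟨h3, hχ⟩ := χ.eq_prod hε (Matrix.GeneralLinearGroup.det (ctGL ε h⁻¹))
  -- One finite set supports all three kinds of factors, so every `finprod` becomes a product over
  -- it and can be rearranged.
  have hfin := Filter.eventually_cofinite.1 (h1.and (h2.and h3))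
  have hS : ∀ v ∉ hfin.toFinset, ‖compFin v (l : AE E)‖ = 1 ∧ ‖compFin v (hermNorm ε h)‖ = 1 ∧
      χ.atFin v (unitsBaseMap K (compFin v) (Matrix.GeneralLinearGroup.det (ctGL ε h⁻¹))) = 1 := by
    intro v hv
    by_contra hc
    exact hv (by simpa using hc)
  have hsub : ∀ {M : Type} [CommMonoid M] (F : HeightOneSpectrum (𝓞 E) → M),
      (∀ v ∉ hfin.toFinset, F v = 1) → ∏ᶠ v, F v = ∏ v ∈ hfin.toFinset, F v := fun F hF =>
    finprod_eq_prod_of_mulSupport_subset _ fun v hv => by_contra fun hc => hv (hF v hc)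
  rw [hχ, adelicAbs, adelicAbs, hsub _ fun v hv => (hS v hv).1, hsub _ fun v hv => (hS v hv).2.1,
    hsub _ fun v hv => (hS v hv).2.2]
  simp only [localFactor_glBaseMap hε]
  rw [hsub _ fun v hv => by
    obtain ⟨a1, a2, a3⟩ := hS v hv
    rw [a1, a2, a3]; simp]
  simp only [Finset.prod_mul_distrib, Finset.prod_zpow, prod_ofReal_cpow _ _ fun _ => norm_nonneg _]
  rw [Complex.ofReal_mul (∏ v, _), Complex.ofReal_mul (∏ v, _), mul_zpow,
    Complex.mul_cpow_ofReal_nonneg (Finset.prod_nonneg fun _ _ => norm_nonneg _)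
      (Finset.prod_nonneg fun _ _ => norm_nonneg _)]
  push_cast
  ring

end Global

end SiegelSim

end

open SiegelSim in
theorem lemma19 {E K : Type*} [Field E] [NumberField E] [IsTotallyReal E]
    [Field K] [NumberField K] [IsTotallyComplex K]
    [Algebra E K] [Algebra.IsQuadraticExtension E K]
    (ε : K ≃ₐ[E] K) (hε : ε ≠ 1) (n : ℕ)
    (χ : HeckeChar E K) (s : ℂ) (f : SiegelSection ε n χ s)
    (h : GL (Fin n) (AE E ⊗[E] K)) (l : (AE E)ˣ)
    (β : Matrix (Fin n) (Fin n) K) (hβ : (β.map ε)ᵀ = β)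
    (β' : Matrix (Fin n) (Fin n) (AE E ⊗[E] K))
    (hβ' : β' = ((l⁻¹ : (AE E)ˣ) : AE E) •
      ((h⁻¹).val * adelicMat E β * (ctGL ε h⁻¹).val)) :
    (CoeffConverges (adelicMat E β) (mGU ε h l) f ↔ CoeffConverges β' 1 f) ∧
    (CoeffConverges β' 1 f →
      fourierCoeff (adelicMat E β) (mGU ε h l) f =
        ((adelicAbs (l : AE E) : ℝ) : ℂ) ^ (-((n : ℤ) ^ 2)) *
        (χ.toHom (Matrix.GeneralLinearGroup.det (ctGL ε h⁻¹)) : ℂ) *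
        ((adelicAbs (toBase (((ctGL ε h⁻¹).val * (h⁻¹).val).det)) : ℝ) : ℂ) ^ ((n : ℂ) - s) *
        fourierCoeff β' 1 f) := by
  have hI := coeffInf_mGU hε f h l (adelicMat E β)
  have hF := coeffFin_mGU hε f h l (adelicMat E β)
  rw [← hβ'] at hI hF
  set c : HeightOneSpectrum (𝓞 E) → ℂ := fun v =>
    localFactor ε (χ.atFin v) s (glBaseMap (compFin v) h)
      (Units.map (compFin v : AE E →* v.adicCompletion E) l) with hc
  have hc0 : ∀ v, c v ≠ 0 := fun v => localFactor_ne_zero hε _ _ _ _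
  have hcfin : c.mulSupport.Finite :=
    Filter.eventually_cofinite.1 (eventually_localFactor_eq_one hε χ s h l)
  have hcfin' : (fun v => (c v)⁻¹).mulSupport.Finite :=
    hcfin.subset fun v hv hv' => hv (by simp [hv'])
  have hcm : Multipliable c := multipliable_of_hasFiniteMulSupport hcfin
  have heq : coeffFin (adelicMat E β) (mGU ε h l) f = fun v => c v * coeffFin β' 1 f v :=
    funext fun v => (hF v).2
  -- One multiplies by the family c or by c⁻¹. Both are multipliable because c differs from 1 at
  -- only finitely many places, and c⁻¹ undoes c because c vanishes nowhere.
  have hmul : Multipliable (coeffFin (adelicMat E β) (mGU ε h l) f) ↔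
      Multipliable (coeffFin β' 1 f) := by
    rw [heq]
    refine ⟨fun H => ?_, fun H => hcm.mul H⟩
    refine ((multipliable_of_hasFiniteMulSupport hcfin').mul H).congr fun v => ?_
    rw [← mul_assoc, inv_mul_cancel₀ (hc0 v), one_mul]
  refine ⟨?_, fun hconv => ?_⟩
  · rw [CoeffConverges, CoeffConverges, hmul]
    simp only [fun v => (hI v).1, fun v => (hF v).1]
  · have hprod := prod_localFactor hε χ s h l
    rw [hermNorm] at hprod
    -- Multipliability of both families lets the infinite product split, and the product of c is a
    -- finite one.
    rw [← hprod, SiegelSim.fourierCoeff, SiegelSim.fourierCoeff, heq, hcm.tprod_mul hconv.2.2,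
      tprod_eq_finprod hcfin, Finset.prod_congr rfl fun v _ => (hI v).2, Finset.prod_mul_distrib]
    ring
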